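/- Let $\overrightarrow{Q}=(I,\Omega)$ be a Dynkin quiver, i.e. a quiver whose underlying graph is a Dynkin diagram of type $A_n$ ($n\ge 1$), $D_n$ ($n\ge 4$), $E_6$, $E_7$ or $E_8$. Let $R^+\subset\mathbb{Z}^I$ be the set of positive roots of its root system, with simple roots $\alpha_i$ and simple reflections $s_i$ ($i\in I$). Let $w_0=s_{i_1}s_{i_2}\cdots s_{i_N}$ be a reduced expression of the longest element of the Weyl group that is adapted to $\Omega$: for each $k$, the vertex $i_k$ is a sink of the quiver obtained from $\overrightarrow{Q}$ by successively reversing all the arrows at $i_1,\dots,i_{k-1}$. Put $\beta_k=s_{i_1}\cdots s_{i_{k-1}}(\alpha_{i_k})$, so that $R^+=\{\beta_1,\dots,\beta_N\}$, and order $R^+$ by $\beta_k\prec\beta_l$ if and only if $k>l$. Let $\nu\in\mathbb{N}[I]$. A Kostant partition of $\nu$ is a sequence $\lambda=(\lambda_1,\dots,\lambda_l)$ of positive roots with $\lambda_1\succeq\cdots\succeq\lambda_l$ and $\lambda_1+\cdots+\lambda_l=\nu$; let $\mathrm{KP}(\nu)$ be the set of these. For $\kappa,\lambda\in\mathrm{KP}(\nu)$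 write $\kappa\prec\lambda$ if both of the following hold, where $\lambda'$ and $\kappa'$ are the reversed sequences: (i) there is a $k$ such that $\kappa_k,\lambda_k$ are both defined, $\kappa_i=\lambda_i$ for all $i<k$, and $\kappa_k\prec\lambda_k$; (ii) there is a $k$ such that $\kappa'_k,\lambda'_k$ are both defined, $\kappa'_i=\lambda'_i$ for all $i<k$, and $\kappa'_k\succ\lambda'_k$. Let $\mathbb{E}_\nu=\bigoplus_{h:i\to j}\mathrm{Hom}(\mathbb{C}^{\nu_i},\mathbb{C}^{\nu_j})$, with the Zariski topology and the action of $\mathrm{GL}(\nu)=\prod_{i\in I}\mathrm{GL}_{\nu_i}(\mathbb{C})$ by change of basis. For $\lambda\in\mathrm{KP}(\nu)$ let $\mathcal{O}_\lambda\subset\mathbb{E}_\nu$ be the set of the points whose representation is isomorphic to $M(\lambda_1)\oplus\cdots\oplus M(\lambda_l)$, where $M(\beta)$ denotes an indecomposable representation with dimension vector $\beta$. Then $\mathbb{E}_\nu$ has exactly one open $\mathrm{GL}(\nu)$-orbit (the orbit of the rigid representation), there is exactly one $\nu^0\in\mathrm{KP}(\nu)$ such that $\mathcal{O}_{\nu^0}$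 is this orbit, and $\nu^0$ is the smallest element of $\mathrm{KP}(\nu)$: $\nu^0\prec\lambda$ for every $\lambda\in\mathrm{KP}(\nu)$ with $\lambda\neq\nu^0$, and there is no $\lambda\in\mathrm{KP}(\nu)$ with $\lambda\prec\nu^0$. -/

import Mathlib

noncomputable section

/-! ### Dynkin quivers -/

/-- The Cartan matrix of (the underlying graph of) a quiver: `2` on the diagonal, and minus the
number of arrows joining `i` and `j`, in either direction, off the diagonal. -/
def quiverCartan (I : Type*) [DecidableEq I] [Quiver I] : Matrix I I ℤ :=
  Matrix.of fun i j =>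
    if i = j then 2 else -((Nat.card (i ⟶ j) : ℤ) + (Nat.card (j ⟶ i) : ℤ))

/-- A Dynkin quiver: its underlying graph is a Dynkin diagram of type `A_n` (`n ≥ 1`),
`D_n` (`n ≥ 4`), `E₆`, `E₇` or `E₈`; the orientation is arbitrary. -/
structure IsDynkinQuiver (I : Type*) [DecidableEq I] [Quiver I] : Prop where
  finite_arrows : ∀ i j : I, Finite (i ⟶ j)
  no_loops : ∀ i : I, IsEmpty (i ⟶ i)
  type_ADE :
    (∃ n : ℕ, 1 ≤ n ∧ ∃ e : I ≃ Fin n, Matrix.reindex e e (quiverCartan I) = CartanMatrix.A n) ∨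
    (∃ n : ℕ, 4 ≤ n ∧ ∃ e : I ≃ Fin n, Matrix.reindex e e (quiverCartan I) = CartanMatrix.D n) ∨
    (∃ e : I ≃ Fin 6, Matrix.reindex e e (quiverCartan I) = CartanMatrix.E₆) ∨
    (∃ e : I ≃ Fin 7, Matrix.reindex e e (quiverCartan I) = CartanMatrix.E₇) ∨
    (∃ e : I ≃ Fin 8, Matrix.reindex e e (quiverCartan I) = CartanMatrix.E₈)

section RootSystem

variable {I : Type*} [Fintype I] [DecidableEq I] [Quiver I]

/-! ### Weyl group, positive roots, reduced expressions

The root lattice is `I → ℤ`, and the simple root at `i` is `Pi.single i 1`. -/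

/-- The simple reflection `s_i x = x - (∑ j, a_{ij} x_j) α_i` of the root lattice. -/
def simpleReflection (i : I) : Module.End ℤ (I → ℤ) where
  toFun x := x - (∑ j, quiverCartan I i j * x j) • (Pi.single i (1 : ℤ) : I → ℤ)
  map_add' x y := by
    simp only [Pi.add_apply, mul_add, Finset.sum_add_distrib, add_smul]
    abel
  map_smul' c x := by
    simp only [Pi.smul_apply, smul_eq_mul, RingHom.id_apply, smul_sub, smul_smul,
      Finset.mul_sum, mul_left_comm]

/-- The Weyl group element `s_{i_1} s_{i_2} ⋯ s_{i_m}` of a word `i_1 i_2 … i_m`. (The simple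
reflections are involutions, so every element of the Weyl group is of this form.) -/
def wordProd (w : List I) : Module.End ℤ (I → ℤ) :=
  (w.map simpleReflection).prod

/-- The length of a Weyl group element. -/
def weylLength (g : Module.End ℤ (I → ℤ)) : ℕ :=
  sInf {m : ℕ | ∃ u : List I, u.length = m ∧ wordProd u = g}

/-- `β` is a positive root: it is a nonnegative vector conjugate to a simple root under the Weyl
group. -/
def IsPositiveRoot (β : I → ℤ) : Prop :=
  0 ≤ β ∧ ∃ (u : List I) (i : I), β = wordProd u (Pi.single i 1)

/-- `w` is a reduced expression of the longest element `w₀` of the Weyl group. -/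
def IsReducedWordOfLongest (w : List I) : Prop :=
  weylLength (wordProd w) = w.length ∧
    ∀ u : List I, weylLength (wordProd u) ≤ weylLength (wordProd w)

/-- Reverse all the arrows that start or end at `i` (an orientation being given by the relation
"there is an arrow from `a` to `b`"). -/
def reverseAt (i : I) (Ω : I → I → Prop) : I → I → Prop :=
  fun a b => if a = i ∨ b = i then Ω b a else Ω a b

/-- The word `i_1 i_2 … i_m` is adapted to the orientation `Ω`: `i_1` is a sink of `Ω`, and
`i_2 … i_m` is adapted to the orientation obtained by reversing the arrows at `i_1`. -/
def IsAdaptedTo : (I → I → Prop) → List I → Prop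
  | _, [] => True
  | Ω, i :: w => (∀ j, ¬ Ω i j) ∧ IsAdaptedTo (reverseAt i Ω) w

/-- The word `w` is adapted to the orientation of the quiver `I`. -/
def IsAdaptedWord (w : List I) : Prop :=
  IsAdaptedTo (fun i j : I => Nonempty (i ⟶ j)) w

/-- The root `β_k = s_{i_1} ⋯ s_{i_{k-1}} α_{i_k}` of a word `i_1 … i_N`
(with `k` counted from `0`). -/
def wordRoot (w : List I) (k : Fin w.length) : I → ℤ :=
  wordProd (w.take k) (Pi.single (w.get k) 1)

/-- The order `≺` on the positive roots: the convex order attached to the word `w` is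
`β_1 < β_2 < ⋯ < β_N`, and `≺` is its opposite, i.e. `β_k ≺ β_l` iff `l < k`. -/
def rootPrec (w : List I) (β γ : I → ℤ) : Prop :=
  ∃ k l : Fin w.length, l < k ∧ β = wordRoot w k ∧ γ = wordRoot w l

/-! ### Kostant partitions and their order -/

/-- A Kostant partition of `ν`: a sequence `λ_1 ⪰ λ_2 ⪰ ⋯ ⪰ λ_l` of positive roots with
sum `ν`. -/
structure KostantPartition (w : List I) (ν : I → ℕ) where
  parts : List (I → ℤ)
  isPositiveRoot : ∀ β ∈ parts, IsPositiveRoot β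
  sorted : parts.Pairwise fun β γ => rootPrec w γ β ∨ γ = β
  sum_eq : parts.sum = fun i => (ν i : ℤ)

end RootSystem

/-- At the first place where the sequences `a` and `b` differ both are defined, and there their
entries are related by `r`. -/
def FirstDiff {α : Type*} (r : α → α → Prop) (a b : List α) : Prop :=
  ∃ (k : ℕ) (ha : k < a.length) (hb : k < b.length), a.take k = b.take k ∧ r a[k] b[k]

/-- The order `≺` on Kostant partitions. `κ ≺ μ` means that at the first difference from the
left `κ` has the `≺`-smaller entry, and at the first difference from the right `κ` has the
`≺`-larger entry. -/
def KostantPartition.Prec {I : Type*} [Fintype I] [DecidableEq I] [Quiver I] {w : List I}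
    {ν : I → ℕ} (κ μ : KostantPartition w ν) : Prop :=
  FirstDiff (rootPrec w) κ.parts μ.parts ∧
    FirstDiff (fun β γ => rootPrec w γ β) κ.parts.reverse μ.parts.reverse

/-! ### Representations over `ℂ` -/

/-- A complex representation of the quiver `I`. -/
structure QuiverRep (I : Type*) [Quiver I] where
  space : I → Type
  [addCommGroup : ∀ i, AddCommGroup (space i)]
  [module : ∀ i, Module ℂ (space i)]
  map : ∀ {i j : I}, (i ⟶ j) → space i →ₗ[ℂ] space j

attribute [instance] QuiverRep.addCommGroup QuiverRep.module

namespace QuiverRep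

variable {I : Type*} [Quiver I]

/-- Isomorphism of representations. -/
def IsIso (M N : QuiverRep I) : Prop :=
  ∃ e : ∀ i, M.space i ≃ₗ[ℂ] N.space i,
    ∀ (i j : I) (h : i ⟶ j) (v : M.space i), e j (M.map h v) = N.map h (e i v)

/-- The direct sum of finitely many representations. -/
def directSum {l : ℕ} (M : Fin l → QuiverRep I) : QuiverRep I where
  space i := ∀ k : Fin l, (M k).space i
  map h := LinearMap.piMap fun k => (M k).map h

/-- The family of subspaces `U` is a subrepresentation of `M`. -/
def IsSubrep (M : QuiverRep I) (U : ∀ i, Submodule ℂ (M.space i)) : Prop :=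
  ∀ (i j : I) (h : i ⟶ j), ∀ v ∈ U i, M.map h v ∈ U j

/-- `M` is indecomposable: it is nonzero, and it is not the direct sum of two nonzero
subrepresentations. -/
def IsIndecomposable (M : QuiverRep I) : Prop :=
  (∃ i, Nontrivial (M.space i)) ∧
    ∀ U W : ∀ i, Submodule ℂ (M.space i), M.IsSubrep U → M.IsSubrep W →
      (∀ i, IsCompl (U i) (W i)) → (∀ i, U i = ⊥) ∨ (∀ i, W i = ⊥)

/-- `M` is finite-dimensional with dimension vector `d`. -/
def HasDimVector (M : QuiverRep I) (d : I → ℤ) : Prop :=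
  ∀ i, FiniteDimensional ℂ (M.space i) ∧ (Module.finrank ℂ (M.space i) : ℤ) = d i

end QuiverRep

section RepSpace

variable {I : Type*} [Quiver I]

/-! ### The representation space `E_ν`, its orbits and its Zariski topology -/

/-- The affine space `E_ν = ⨁_{h : i ⟶ j} Hom(ℂ^{ν_i}, ℂ^{ν_j})`. -/
abbrev RepSpace (ν : I → ℕ) : Type _ :=
  ∀ ⦃i j : I⦄, (i ⟶ j) → Matrix (Fin (ν j)) (Fin (ν i)) ℂ

/-- The representation given by a point of `E_ν`. -/
def RepSpace.toRep {ν : I → ℕ} (x : RepSpace ν) : QuiverRep I where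
  space i := Fin (ν i) → ℂ
  map h := Matrix.mulVecLin (x h)

/-- The orbit of `x` under `GL(ν) = ∏ GL(ν_i)`, acting by `(g x)_h = g_j x_h g_i⁻¹` for
`h : i ⟶ j`. -/
def glOrbit {ν : I → ℕ} (x : RepSpace ν) : Set (RepSpace ν) :=
  {y | ∃ g : ∀ i, GL (Fin (ν i)) ℂ, ∀ ⦃i j : I⦄ (h : i ⟶ j),
    y h = (g j : Matrix (Fin (ν j)) (Fin (ν j)) ℂ) * x h *
      (((g i)⁻¹ : GL (Fin (ν i)) ℂ) : Matrix (Fin (ν i)) (Fin (ν i)) ℂ)}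

/-- The index set of the coordinates (matrix entries) of `E_ν`. -/
abbrev RepCoord (ν : I → ℕ) : Type _ :=
  Σ (i : I) (j : I) (_ : i ⟶ j), Fin (ν j) × Fin (ν i)

/-- The coordinates of a point of `E_ν`. -/
def RepSpace.coord {ν : I → ℕ} (x : RepSpace ν) : RepCoord ν → ℂ :=
  fun c => x c.2.2.1 c.2.2.2.1 c.2.2.2.2

/-- `U` is Zariski open in `E_ν`: it is the complement of the common zero locus of a set of
polynomials in the coordinates. -/
def IsZariskiOpen {ν : I → ℕ} (U : Set (RepSpace ν)) : Prop :=
  ∃ S : Set (MvPolynomial (RepCoord ν) ℂ), U = {x | ∃ f ∈ S, MvPolynomial.eval x.coord f ≠ 0}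

end RepSpace

/-- The set `O_κ` of all points of `E_ν` whose representation is isomorphic to
`M(κ_1) ⊕ ⋯ ⊕ M(κ_l)`, with `M(κ_k)` indecomposable of dimension vector `κ_k`. -/
def KostantPartition.orbit {I : Type*} [Fintype I] [DecidableEq I] [Quiver I] {w : List I}
    {ν : I → ℕ} (κ : KostantPartition w ν) : Set (RepSpace ν) :=
  {x | ∃ M : Fin κ.parts.length → QuiverRep I,
    (∀ k, (M k).IsIndecomposable ∧ (M k).HasDimVector (κ.parts.get k)) ∧
      x.toRep.IsIso (QuiverRep.directSum M)}

end

/-! Write ⟨·,·⟩ for the Euler form. `Hom` and Ext¹ are the kernel and cokernel of `delta`, so dim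
Hom(M, N) − dim Ext¹(M, N) = ⟨dim M, dim N⟩ (`homDim_sub_eulerForm`). Three facts carry the proof.

Indecomposables. The Cartan form of a Dynkin diagram is positive definite. Hence every
indecomposable has only scalar endomorphisms and no self-extensions
(`IsIndecomposable.homDim_self_eq_one_and_extVanish`). Its dimension vector is a positive root,
which determines it up to isomorphism, and every positive root occurs. An adapted reduced word
satisfies ⟨β_l, β_k⟩ ≤ 0 for k < l, and this upgrades to Hom(M(β_l), M(β_k)) = 0
(`IsIndecomposable.homDim_eq_zero`). So the matrix of the numbers dim Hom(M(β), M(γ)) is triangular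
for the order on roots, with ones on the diagonal.

Genericity. A representation of dimension vector ν with the smallest endomorphism algebra is rigid
(`exists_rigid`). The orbit of a rigid point is open, because its identity map deforms to
homomorphisms from nearby points (`exists_polyFun_of_extVanish`). As 𝔼_ν is irreducible, there is
only one open orbit, and by semicontinuity dim Hom(·, X) and dim Hom(X, ·) take their smallest
values on it (`ExtVanish.homDim_le_left`, `ExtVanish.homDim_le_right`).

Comparison (`firstDiff_of_sum_le`, `prec_of_extVanish`). Let β be the entry of ν⁰ at its first
difference from λ, and suppose that the entry of λ there is smaller. Then no remaining part of λ
maps nontrivially to M(β), whereas M(β) itself does, so dim Hom(·, M(β)) would be larger at ν⁰ than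
at λ, against minimality. Read from the right, the same argument uses Hom(M(β), ·). Neither sequence
is a proper prefix of the other, since the sums agree. Asymmetry of ≺ gives the rest. -/

noncomputable section

open Module Matrix

universe u v

/-! ### Positivity of the Cartan forms of type `A`, `D`, `E` -/

/-- The integral quadratic form of the matrix `C` is positive definite. -/
def IntPosDef {ι : Type*} [Fintype ι] (C : Matrix ι ι ℤ) : Prop :=
  ∀ x : ι → ℤ, x ⬝ᵥ C *ᵥ x ≤ 0 → x = 0

lemma IntPosDef.of_reindex {ι κ : Type*} [Fintype ι] [Fintype κ] {C : Matrix ι ι ℤ} (e : ι ≃ κ)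
    (h : IntPosDef (Matrix.reindex e e C)) : IntPosDef C := by
  intro x hx
  have := h (x ∘ e.symm) (by
    have h2 : (Matrix.reindex e e C) *ᵥ (x ∘ e.symm) = (C *ᵥ x) ∘ e.symm := by
      ext k
      simp only [mulVec, dotProduct, reindex_apply, submatrix_apply, Function.comp]
      exact Equiv.sum_comp e.symm (fun j => C (e.symm k) j * x j)
    rw [h2, comp_equiv_symm_dotProduct]
    simpa [Function.comp_assoc] using hx)
  ext i
  simpa using congrFun this (e i)

/-- A form that dominates the square of the coordinate `0` and is definite. -/
def HeadDominates {n : ℕ} (C : Matrix (Fin (n + 1)) (Fin (n + 1)) ℤ) : Prop :=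
  ∀ x : Fin (n + 1) → ℤ, x 0 ^ 2 ≤ x ⬝ᵥ C *ᵥ x ∧ (x ⬝ᵥ C *ᵥ x = 0 → x = 0)

lemma HeadDominates.intPosDef {n : ℕ} {C : Matrix (Fin (n + 1)) (Fin (n + 1)) ℤ}
    (h : HeadDominates C) : IntPosDef C := fun x hx =>
  (h x).2 (le_antisymm hx ((sq_nonneg _).trans (h x).1))

/-- A new vertex 0 is joined by one edge to the old head, and q'(x) = x₀² + (x₀ − x₁)² + (q − x₁²).
Definiteness alone would not survive this step; the domination of the head coordinate does. -/
lemma HeadDominates.extend {n : ℕ} {C : Matrix (Fin (n + 1)) (Fin (n + 1)) ℤ}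
    {C' : Matrix (Fin (n + 2)) (Fin (n + 2)) ℤ} (h : HeadDominates C)
    (h00 : C' 0 0 = 2) (h01 : C' 0 1 = -1) (h10 : C' 1 0 = -1)
    (h0 : ∀ i : Fin n, C' 0 i.succ.succ = 0) (h0' : ∀ i : Fin n, C' i.succ.succ 0 = 0)
    (hs : ∀ i j, C' (Fin.succ i) (Fin.succ j) = C i j) : HeadDominates C' := by
  intro x
  have key : x ⬝ᵥ C' *ᵥ x = x 0 ^ 2 + (x 0 - x 1) ^ 2 +
      ((fun i => x (Fin.succ i)) ⬝ᵥ C *ᵥ (fun i => x (Fin.succ i)) - x 1 ^ 2) := by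
    have e0 : (C' *ᵥ x) 0 = 2 * x 0 - x 1 := by
      simp only [mulVec, dotProduct]
      rw [Fin.sum_univ_succ, Fin.sum_univ_succ]
      simp [h00, h0, h01]
      ring
    have es : ∀ i : Fin (n + 1), (C' *ᵥ x) i.succ =
        C' i.succ 0 * x 0 + (C *ᵥ (fun i => x (Fin.succ i))) i := by
      intro i
      simp only [mulVec, dotProduct]
      rw [Fin.sum_univ_succ]
      simp [hs]
    have e1 : ∑ i : Fin (n + 1), x i.succ * (C' i.succ 0 * x 0) = - x 1 * x 0 := by
      rw [Fin.sum_univ_succ]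
      simp [h10, h0']
    conv_lhs => rw [dotProduct, Fin.sum_univ_succ, e0]
    simp only [es, mul_add, Finset.sum_add_distrib, e1]
    simp only [dotProduct]
    ring
  have h1 := h (fun i => x (Fin.succ i))
  have hx1 : x (Fin.succ 0) = x 1 := rfl
  simp only [hx1] at h1
  refine ⟨by rw [key]; nlinarith [sq_nonneg (x 0 - x 1), h1.1], fun hz => ?_⟩
  rw [key] at hz
  have hx0 : x 0 ^ 2 = 0 := by nlinarith [sq_nonneg (x 0 - x 1), h1.1, sq_nonneg (x 0)]
  have hx1' : (x 0 - x 1) ^ 2 = 0 := by nlinarith [sq_nonneg (x 0 - x 1), h1.1, sq_nonneg (x 0)]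
  have h0 : x 0 = 0 := by simpa using hx0
  have h1' : x 1 = 0 := by
    have := pow_eq_zero_iff (two_ne_zero) |>.1 hx1'
    linarith
  have := h1.2 (by rw [h0, h1'] at hz; simpa using hz)
  ext i
  refine Fin.cases h0 (fun j => congrFun this j) i

lemma headDominates_cartanA (n : ℕ) : HeadDominates (CartanMatrix.A (n + 1)) := by
  induction n with
  | zero =>
    suffices h : HeadDominates (n := 0) (CartanMatrix.A 1) from h
    intro x
    have : x ⬝ᵥ CartanMatrix.A 1 *ᵥ x = 2 * x 0 ^ 2 := by
      simp [CartanMatrix.A_one, mulVec, dotProduct]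
      ring
    refine ⟨by rw [this]; nlinarith [sq_nonneg (x 0)], fun h => ?_⟩
    rw [this] at h
    ext i
    fin_cases i
    simpa using h
  | succ n ih =>
    refine ih.extend ?_ ?_ ?_ ?_ ?_ ?_ <;> intros <;>
      simp only [CartanMatrix.A, Matrix.of_apply, Fin.ext_iff, Fin.val_succ, Fin.val_zero,
        Fin.val_one] <;> grind

/-- The induction starts from the fork D₃ = A₃, whose head is the branch vertex, and lengthens the
tail. -/
lemma headDominates_cartanD (n : ℕ) : HeadDominates (CartanMatrix.D (n + 3)) := by
  induction n with
  | zero =>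
    suffices h : HeadDominates (n := 2) (CartanMatrix.D 3) from h
    intro x
    have : x ⬝ᵥ CartanMatrix.D 3 *ᵥ x =
        (x 1 + x 2 - x 0) ^ 2 + (x 1 - x 2) ^ 2 + x 0 ^ 2 := by
      simp [CartanMatrix.D_three, mulVec, dotProduct, Fin.sum_univ_succ]
      ring
    have h1 := sq_nonneg (x 1 + x 2 - x 0)
    have h2 := sq_nonneg (x 1 - x 2)
    have h3 := sq_nonneg (x 0)
    refine ⟨by rw [this]; linarith, fun h => ?_⟩
    rw [this] at h
    have e1 : x 1 + x 2 - x 0 = 0 := pow_eq_zero_iff two_ne_zero |>.1 (by linarith)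
    have e2 : x 1 - x 2 = 0 := pow_eq_zero_iff two_ne_zero |>.1 (by linarith)
    have e3 : x 0 = 0 := pow_eq_zero_iff two_ne_zero |>.1 (by linarith)
    ext i
    fin_cases i <;> simp <;> omega
  | succ n ih =>
    refine ih.extend ?_ ?_ ?_ ?_ ?_ ?_ <;> intros <;>
      simp only [CartanMatrix.D, Matrix.of_apply, Fin.ext_iff, Fin.val_succ, Fin.val_zero,
        Fin.val_one] <;> grind

/-- This is the form of E₈ with branch vertex d. E₇ and E₆ are obtained by putting h = 0 and g = h =
0. -/
lemma cartanE_form_definite (a b c d e f g h : ℤ)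
    (hq : 2 * (a ^ 2 + b ^ 2 + c ^ 2 + d ^ 2 + e ^ 2 + f ^ 2 + g ^ 2 + h ^ 2) -
      2 * (a * c + b * d + c * d + d * e + e * f + f * g + g * h) ≤ 0) :
    a = 0 ∧ b = 0 ∧ c = 0 ∧ d = 0 ∧ e = 0 ∧ f = 0 ∧ g = 0 ∧ h = 0 := by
  -- Squares are completed along the three arms, from the tips towards d; the factor 60 clears the
  -- denominators, and the positive coefficient left at d² is what singles out E₈.
  have key : 60 * (2 * (a ^ 2 + b ^ 2 + c ^ 2 + d ^ 2 + e ^ 2 + f ^ 2 + g ^ 2 + h ^ 2) -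
      2 * (a * c + b * d + c * d + d * e + e * f + f * g + g * h)) =
      30 * (2 * h - g) ^ 2 + 10 * (3 * g - 2 * f) ^ 2 + 5 * (4 * f - 3 * e) ^ 2 +
      3 * (5 * e - 4 * d) ^ 2 + 30 * (2 * b - d) ^ 2 + 30 * (2 * a - c) ^ 2 +
      10 * (3 * c - 2 * d) ^ 2 + 2 * d ^ 2 := by ring
  have h1 := sq_nonneg (2 * h - g)
  have h2 := sq_nonneg (3 * g - 2 * f)
  have h3 := sq_nonneg (4 * f - 3 * e)
  have h4 := sq_nonneg (5 * e - 4 * d)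
  have h5 := sq_nonneg (2 * b - d)
  have h6 := sq_nonneg (2 * a - c)
  have h7 := sq_nonneg (3 * c - 2 * d)
  have h8 := sq_nonneg d
  have e1 : 2 * h - g = 0 := pow_eq_zero_iff two_ne_zero |>.1 (by linarith)
  have e2 : 3 * g - 2 * f = 0 := pow_eq_zero_iff two_ne_zero |>.1 (by linarith)
  have e3 : 4 * f - 3 * e = 0 := pow_eq_zero_iff two_ne_zero |>.1 (by linarith)
  have e4 : 5 * e - 4 * d = 0 := pow_eq_zero_iff two_ne_zero |>.1 (by linarith)
  have e5 : 2 * b - d = 0 := pow_eq_zero_iff two_ne_zero |>.1 (by linarith)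
  have e6 : 2 * a - c = 0 := pow_eq_zero_iff two_ne_zero |>.1 (by linarith)
  have e7 : 3 * c - 2 * d = 0 := pow_eq_zero_iff two_ne_zero |>.1 (by linarith)
  have e8 : d = 0 := pow_eq_zero_iff two_ne_zero |>.1 (by linarith)
  omega

lemma intPosDef_cartanE₆ : IntPosDef CartanMatrix.E₆ := by
  intro x hx
  have := cartanE_form_definite (x 0) (x 1) (x 2) (x 3) (x 4) (x 5) 0 0 (by
    refine le_of_eq_of_le ?_ hx
    simp [CartanMatrix.E₆, mulVec, dotProduct, Fin.sum_univ_succ]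
    ring)
  ext i
  fin_cases i <;> simp <;> omega

lemma intPosDef_cartanE₇ : IntPosDef CartanMatrix.E₇ := by
  intro x hx
  have := cartanE_form_definite (x 0) (x 1) (x 2) (x 3) (x 4) (x 5) (x 6) 0 (by
    refine le_of_eq_of_le ?_ hx
    simp [CartanMatrix.E₇, mulVec, dotProduct, Fin.sum_univ_succ]
    ring)
  ext i
  fin_cases i <;> simp <;> omega

lemma intPosDef_cartanE₈ : IntPosDef CartanMatrix.E₈ := by
  intro x hx
  have := cartanE_form_definite (x 0) (x 1) (x 2) (x 3) (x 4) (x 5) (x 6) (x 7) (by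
    refine le_of_eq_of_le ?_ hx
    simp [CartanMatrix.E₈, mulVec, dotProduct, Fin.sum_univ_succ]
    ring)
  ext i
  fin_cases i <;> simp <;> omega

theorem IsDynkinQuiver.intPosDef {I : Type*} [Fintype I] [DecidableEq I] [Quiver I]
    (hQ : IsDynkinQuiver I) : IntPosDef (quiverCartan I) := by
  rcases hQ.type_ADE with ⟨n, hn, e, he⟩ | ⟨n, hn, e, he⟩ | ⟨e, he⟩ | ⟨e, he⟩ | ⟨e, he⟩ <;>
    apply IntPosDef.of_reindex e <;> rw [he]
  · obtain ⟨m, rfl⟩ : ∃ m, n = m + 1 := ⟨n - 1, by omega⟩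
    exact (headDominates_cartanA m).intPosDef
  · obtain ⟨m, rfl⟩ : ∃ m, n = m + 3 := ⟨n - 3, by omega⟩
    exact (headDominates_cartanD m).intPosDef
  · exact intPosDef_cartanE₆
  · exact intPosDef_cartanE₇
  · exact intPosDef_cartanE₈

/-! ### Roots, reduced words and the Euler form -/

section Orientation

variable {I : Type*} [DecidableEq I] [Quiver I]

lemma quiverCartan_symm (i j : I) : quiverCartan I i j = quiverCartan I j i := by
  simp only [quiverCartan, of_apply, eq_comm (a := i), add_comm]

lemma quiverCartan_self (i : I) : quiverCartan I i i = 2 := by simp [quiverCartan]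

lemma quiverCartan_nonpos {i j : I} (h : i ≠ j) : quiverCartan I i j ≤ 0 := by
  simp only [quiverCartan, of_apply, if_neg h]
  omega

/-- `Ω` orients every edge of the underlying graph in exactly one way. -/
structure IsOrientation (Ω : I → I → Prop) : Prop where
  irrefl : ∀ i, ¬ Ω i i
  total : ∀ i j, i ≠ j → quiverCartan I i j ≠ 0 → Ω i j ∨ Ω j i
  asymm : ∀ i j, Ω i j → ¬ Ω j i

lemma IsOrientation.reverseAt {Ω : I → I → Prop} (h : IsOrientation Ω) (i : I) :
    IsOrientation (reverseAt i Ω) where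
  irrefl j := by
    have := h.irrefl j
    simp [_root_.reverseAt, this]
  total a b hab h0 := by
    have := h.total a b hab h0
    simp only [_root_.reverseAt]
    split_ifs <;> tauto
  asymm a b := by
    have h1 := h.asymm a b
    have h2 := h.asymm b a
    simp only [_root_.reverseAt]
    split_ifs <;> tauto

end Orientation

section Roots

variable {I : Type*} [Fintype I] [DecidableEq I] [Quiver I]

variable (I) in
/-- The symmetric bilinear form of the Cartan matrix. -/
def cartanForm : LinearMap.BilinForm ℤ (I → ℤ) := Matrix.toBilin' (quiverCartan I)

/-- The matrix of the Euler form of the orientation `Ω` of the Cartan matrix. -/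
def orientedMatrix (Ω : I → I → Prop) : Matrix I I ℤ :=
  open Classical in
  Matrix.of fun i j => (if i = j then 1 else 0) + if Ω i j then quiverCartan I i j else 0

/-- The Euler form of the orientation `Ω`. -/
def orientedForm (Ω : I → I → Prop) : LinearMap.BilinForm ℤ (I → ℤ) :=
  Matrix.toBilin' (orientedMatrix Ω)

variable (I) in
/-- The Euler form `⟨x, y⟩ = ∑ x_i y_i - ∑_{i → j} x_i y_j` of the quiver. -/
def eulerForm : LinearMap.BilinForm ℤ (I → ℤ) :=
  Matrix.toBilin' (Matrix.of fun i j => (if i = j then 1 else 0) - (Nat.card (i ⟶ j) : ℤ))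

lemma cartanForm_apply (x y : I → ℤ) : cartanForm I x y = x ⬝ᵥ quiverCartan I *ᵥ y := by
  simp [cartanForm, Matrix.toBilin'_apply']

lemma cartanForm_single_left (i : I) (x : I → ℤ) :
    cartanForm I (Pi.single i 1) x = ∑ j, quiverCartan I i j * x j := by
  rw [cartanForm_apply, single_one_dotProduct]
  rfl

lemma cartanForm_comm (x y : I → ℤ) : cartanForm I x y = cartanForm I y x := by
  simp only [cartanForm, Matrix.toBilin'_apply]
  rw [Finset.sum_comm]
  refine Finset.sum_congr rfl fun i _ => Finset.sum_congr rfl fun j _ => ?_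
  rw [quiverCartan_symm j i]
  ring

lemma cartanForm_single_single (i j : I) :
    cartanForm I (Pi.single i 1) (Pi.single j 1) = quiverCartan I i j := by
  simp [cartanForm]

lemma simpleReflection_apply (i : I) (x : I → ℤ) :
    simpleReflection i x = x - cartanForm I (Pi.single i 1) x • Pi.single i 1 := by
  rw [cartanForm_single_left]
  rfl

lemma cartanForm_simpleReflection (i : I) (x y : I → ℤ) :
    cartanForm I (simpleReflection i x) (simpleReflection i y) = cartanForm I x y := by
  simp only [simpleReflection_apply, map_sub, LinearMap.sub_apply, map_smul, LinearMap.smul_apply,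
    smul_eq_mul, cartanForm_single_single, quiverCartan_self, cartanForm_comm _ (Pi.single i 1)]
  ring

lemma simpleReflection_single (i : I) :
    simpleReflection i (Pi.single i 1 : I → ℤ) = -Pi.single i 1 := by
  rw [simpleReflection_apply, cartanForm_single_single, quiverCartan_self, two_smul]
  abel

lemma simpleReflection_simpleReflection (i : I) (x : I → ℤ) :
    simpleReflection i (simpleReflection i x) = x := by
  conv_lhs => rw [simpleReflection_apply i x, map_sub, map_smul, simpleReflection_single,
    simpleReflection_apply]
  simp

lemma simpleReflection_injective (i : I) :
    Function.Injective (simpleReflection i : (I → ℤ) → (I → ℤ)) :=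
  Function.LeftInverse.injective (simpleReflection_simpleReflection i)

lemma simpleReflection_mul_self (i : I) :
    (simpleReflection i * simpleReflection i : Module.End ℤ (I → ℤ)) = 1 :=
  LinearMap.ext (simpleReflection_simpleReflection i)

/-! ### Words in the simple reflections and their roots -/

@[simp] lemma wordProd_nil : wordProd ([] : List I) = 1 := rfl

@[simp] lemma wordProd_cons (i : I) (w : List I) :
    wordProd (i :: w) = simpleReflection i * wordProd w := rfl

lemma wordProd_append (u v : List I) : wordProd (u ++ v) = wordProd u * wordProd v := by
  simp [wordProd]

lemma cartanForm_wordProd (w : List I) (x y : I → ℤ) :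
    cartanForm I (wordProd w x) (wordProd w y) = cartanForm I x y := by
  induction w with
  | nil => rfl
  | cons i w ih => rw [wordProd_cons, Module.End.mul_apply, Module.End.mul_apply,
      cartanForm_simpleReflection, ih]

lemma wordProd_reverse_mul (w : List I) : wordProd w.reverse * wordProd w = 1 := by
  induction w with
  | nil => rfl
  | cons i w ih =>
    rw [List.reverse_cons, wordProd_append, wordProd_cons, wordProd_cons, wordProd_nil, mul_one,
      mul_assoc, ← mul_assoc (simpleReflection i), simpleReflection_mul_self, one_mul, ih]

lemma wordProd_mul_reverse (w : List I) : wordProd w * wordProd w.reverse = 1 := by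
  simpa using wordProd_reverse_mul w.reverse

/-- The roots `β_1, …, β_N` of a word, computed recursively. -/
def wordRoots : List I → List (I → ℤ)
  | [] => []
  | i :: w => Pi.single i 1 :: (wordRoots w).map (simpleReflection i)

lemma length_wordRoots (w : List I) : (wordRoots w).length = w.length := by
  induction w with
  | nil => rfl
  | cons i w ih => simp [wordRoots, ih]

lemma wordProd_take_single (w : List I) (k : ℕ) (hk : k < w.length) :
    wordProd (w.take k) (Pi.single w[k] 1) =
      (wordRoots w)[k]'(by rwa [length_wordRoots]) := by
  induction w generalizing k with
  | nil => simp at hk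
  | cons i w ih =>
    cases k with
    | zero => rfl
    | succ k => simpa [wordRoots] using congrArg (simpleReflection i) (ih k (by simpa using hk))

lemma wordRoot_eq_getElem (w : List I) (k : Fin w.length) :
    wordRoot w k = (wordRoots w)[(k : ℕ)]'(by rw [length_wordRoots]; exact k.2) :=
  wordProd_take_single w k k.2

lemma exists_wordRoot_eq {w : List I} {x : I → ℤ} (h : x ∈ wordRoots w) :
    ∃ k, x = wordRoot w k := by
  obtain ⟨k, hk, rfl⟩ := List.getElem_of_mem h
  rw [length_wordRoots] at hk
  exact ⟨⟨k, hk⟩, (wordRoot_eq_getElem w ⟨k, hk⟩).symm⟩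

lemma wordRoot_mem (w : List I) (k : Fin w.length) : wordRoot w k ∈ wordRoots w := by
  rw [wordRoot_eq_getElem]
  exact List.getElem_mem _

/-- If `g α_j = α_i` then `g s_j = s_i g`. -/
lemma wordProd_mul_simpleReflection {v : List I} {i j : I}
    (h : wordProd v (Pi.single j 1) = Pi.single i 1) :
    wordProd v * simpleReflection j = simpleReflection i * wordProd v := by
  ext1 x
  refine LinearMap.ext fun y => ?_
  generalize LinearMap.single ℤ (fun _ : I => ℤ) x = f
  simp only [LinearMap.comp_apply, Module.End.mul_apply]
  rw [simpleReflection_apply, simpleReflection_apply, map_sub, map_smul, h, ← h,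
    cartanForm_wordProd]

/-! ### Positivity of the Euler form and signs of roots -/

lemma IsDynkinQuiver.cartanForm_eq (hQ : IsDynkinQuiver I) (x y : I → ℤ) :
    cartanForm I x y = eulerForm I x y + eulerForm I y x := by
  simp only [cartanForm, eulerForm, Matrix.toBilin'_apply, of_apply]
  rw [Finset.sum_comm (f := fun i j => y i * _ * x j), ← Finset.sum_add_distrib]
  refine Finset.sum_congr rfl fun i _ => ?_
  rw [← Finset.sum_add_distrib]
  refine Finset.sum_congr rfl fun j _ => ?_
  by_cases h : i = j
  · subst h
    have : IsEmpty (i ⟶ i) := hQ.no_loops i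
    simp [quiverCartan]
    ring
  · simp [quiverCartan, h, Ne.symm h]
    ring

lemma IsDynkinQuiver.eulerForm_pos (hQ : IsDynkinQuiver I)
    {x : I → ℤ} (hx : x ≠ 0) : 0 < eulerForm I x x := by
  by_contra! h
  refine hx (hQ.intPosDef x ?_)
  rw [← cartanForm_apply, hQ.cartanForm_eq]
  omega

lemma cartanForm_nonpos_of_disjoint {x y : I → ℤ} (hx : 0 ≤ x) (hy : 0 ≤ y)
    (h : ∀ i, x i * y i = 0) : cartanForm I x y ≤ 0 := by
  simp only [cartanForm, Matrix.toBilin'_apply]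
  refine Finset.sum_nonpos fun i _ => Finset.sum_nonpos fun j _ => ?_
  by_cases hij : i = j
  · subst hij
    rw [mul_right_comm, h, zero_mul]
  · exact mul_nonpos_of_nonpos_of_nonneg
      (mul_nonpos_of_nonneg_of_nonpos (hx i) (quiverCartan_nonpos hij)) (hy j)

/-- Let x = x⁺ − x⁻. The two parts have disjoint supports, so (x⁺, x⁻) ≤ 0, and each nonzero part
has even positive norm. If both were nonzero, then (x, x) ≥ 2 + 2. -/
lemma IsDynkinQuiver.nonneg_or_nonpos (hQ : IsDynkinQuiver I)
    {x : I → ℤ} (hx : cartanForm I x x = 2) :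
    0 ≤ x ∨ x ≤ 0 := by
  by_contra! h
  have hp : x⁺ ≠ 0 := fun h' => h.2 (posPart_eq_zero.1 h')
  have hn : x⁻ ≠ 0 := fun h' => h.1 (negPart_eq_zero.1 h')
  have h0 : cartanForm I x⁺ x⁻ ≤ 0 := by
    refine cartanForm_nonpos_of_disjoint (posPart_nonneg x) (negPart_nonneg x) fun i => ?_
    rcases le_total (x i) 0 with h | h
    · simp [Pi.posPart_apply, posPart_eq_zero.2 h]
    · simp [Pi.negPart_apply, negPart_eq_zero.2 h]
  have h1 := hQ.eulerForm_pos hp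
  have h2 := hQ.eulerForm_pos hn
  have h3 := hQ.cartanForm_eq x⁺ x⁺
  have h4 := hQ.cartanForm_eq x⁻ x⁻
  rw [← posPart_sub_negPart x] at hx
  simp only [map_sub, LinearMap.sub_apply, cartanForm_comm x⁻ x⁺] at hx
  omega

/-- The simple reflection `s_i` permutes the positive roots other than `α_i`. -/
lemma IsDynkinQuiver.simpleReflection_nonneg (hQ : IsDynkinQuiver I)
    {x : I → ℤ} (hx : cartanForm I x x = 2)
    (h0 : 0 ≤ x) {i : I} (hi : x ≠ Pi.single i 1) : 0 ≤ simpleReflection i x := by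
  -- Otherwise s_i x ≤ 0. Since s_i changes only the coordinate i, the vector x is then supported at
  -- i, and its norm forces x = α_i.
  refine (hQ.nonneg_or_nonpos (by rwa [cartanForm_simpleReflection])).resolve_right fun h => hi ?_
  have hj : ∀ j, j ≠ i → x j = 0 := by
    intro j hj
    refine le_antisymm ?_ (h0 j)
    simpa [simpleReflection_apply, hj] using h j
  have hxi : x = x i • Pi.single i 1 := by
    ext j
    by_cases hji : j = i
    · subst hji
      simp
    · simp [hji, hj j hji]
  have : x i * x i = 1 := by
    rw [hxi] at hx
    simp only [map_smul, LinearMap.smul_apply, smul_eq_mul, cartanForm_single_single,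
      quiverCartan_self] at hx
    linarith
  have h1 : x i = 1 := by
    rcases mul_self_eq_one_iff.1 this with h | h
    · exact h
    · have := h0 i
      simp only [Pi.zero_apply] at this
      omega
  rw [hxi, h1, one_smul]

/-! ### Reduced words and the longest element -/

/-- No word for the same Weyl group element is shorter than `w`. -/
def IsReducedWord (w : List I) : Prop :=
  ∀ u : List I, wordProd u = wordProd w → w.length ≤ u.length

lemma isReducedWord_of_weylLength {w : List I} (h : weylLength (wordProd w) = w.length) :
    IsReducedWord w := fun u hu => by
  rw [← h]
  exact Nat.sInf_le ⟨u, rfl, hu⟩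

lemma exists_word_length_eq (w : List I) :
    ∃ u : List I, u.length = weylLength (wordProd w) ∧ wordProd u = wordProd w :=
  Nat.sInf_mem (s := {m : ℕ | ∃ u : List I, u.length = m ∧ wordProd u = wordProd w})
    ⟨w.length, w, rfl, rfl⟩

lemma IsReducedWord.of_append_right {u v : List I} (h : IsReducedWord (u ++ v)) :
    IsReducedWord v := fun x hx => by
  have := h (u ++ x) (by rw [wordProd_append, wordProd_append, hx])
  simpa using this

lemma IsReducedWord.of_append_left {u v : List I} (h : IsReducedWord (u ++ v)) :
    IsReducedWord u := fun x hx => by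
  have := h (x ++ v) (by rw [wordProd_append, wordProd_append, hx])
  simpa using this

/-- The exchange condition. -/
lemma IsDynkinQuiver.exchange (hQ : IsDynkinQuiver I) (w : List I) (j : I)
    (h : ¬ 0 ≤ wordProd w (Pi.single j 1)) :
    ∃ u : List I, u.length + 1 = w.length ∧
      wordProd u = wordProd w * simpleReflection j := by
  induction w with
  | nil =>
    refine absurd ?_ h
    simp
  | cons i v ih =>
    -- If the suffix v keeps α_j positive, the sign changes at the letter i. Then v α_j = α_i, and
    -- this letter is the one to delete. Otherwise the deleted letter lies in v.
    by_cases hv : 0 ≤ wordProd v (Pi.single j 1)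
    · have hr : cartanForm I (wordProd v (Pi.single j 1)) (wordProd v (Pi.single j 1)) = 2 := by
        rw [cartanForm_wordProd, cartanForm_single_single, quiverCartan_self]
      have hi : wordProd v (Pi.single j 1) = Pi.single i 1 := by
        by_contra hne
        exact h (hQ.simpleReflection_nonneg hr hv hne)
      refine ⟨v, rfl, ?_⟩
      rw [wordProd_cons, mul_assoc, wordProd_mul_simpleReflection hi, ← mul_assoc,
        simpleReflection_mul_self, one_mul]
    · obtain ⟨u, hu, hu'⟩ := ih hv
      exact ⟨i :: u, by simp [hu], by rw [wordProd_cons, wordProd_cons, hu', mul_assoc]⟩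

/-- If the root of the k-th letter were not positive, the exchange condition would shorten the
prefix that ends with this letter. -/
lemma IsReducedWord.nonneg_of_mem (hQ : IsDynkinQuiver I)
    {w : List I} (h : IsReducedWord w) {x : I → ℤ}
    (hx : x ∈ wordRoots w) : 0 ≤ x := by
  obtain ⟨k, rfl⟩ := exists_wordRoot_eq hx
  by_contra hk
  obtain ⟨u, hu, hu'⟩ := hQ.exchange _ _ hk
  have hsplit : w = w.take k ++ [w.get k] ++ w.drop (k + 1) := by simp
  rw [hsplit] at h
  have := h.of_append_left u (by rw [hu', wordProd_append]; rfl)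
  simp only [List.length_append, List.length_singleton] at this
  omega

/-- A repetition of the first root α_i would give a root x of the tail with s_i x = α_i, that is x =
−α_i, but the roots of the reduced tail are nonnegative. -/
lemma IsReducedWord.nodup_wordRoots (hQ : IsDynkinQuiver I)
    {w : List I} (h : IsReducedWord w) : (wordRoots w).Nodup := by
  induction w with
  | nil => exact List.nodup_nil
  | cons i w ih =>
    have hw : IsReducedWord w := h.of_append_right (u := [i])
    refine List.nodup_cons.2 ⟨fun hm => ?_, (ih hw).map (simpleReflection_injective i)⟩
    obtain ⟨x, hx, hxi⟩ := List.mem_map.1 hm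
    have h0 := hw.nonneg_of_mem hQ hx
    have : x = -Pi.single i 1 := by
      rw [← simpleReflection_single, ← hxi, simpleReflection_simpleReflection]
    have h1 := h0 i
    rw [this] at h1
    simp at h1

/-- A positive root that does not occur among the roots of `w` stays positive under `w⁻¹`. -/
lemma IsDynkinQuiver.wordProd_reverse_nonneg (hQ : IsDynkinQuiver I) (w : List I) {x : I → ℤ}
    (hx : cartanForm I x x = 2) (h0 : 0 ≤ x) (hm : x ∉ wordRoots w) :
    0 ≤ wordProd w.reverse x := by
  induction w generalizing x with
  | nil => simpa using h0
  | cons i v ih =>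
    rw [List.reverse_cons, wordProd_append, Module.End.mul_apply]
    simp only [wordRoots, List.mem_cons, List.mem_map, not_or, not_exists, not_and] at hm
    refine ih (x := simpleReflection i x) ?_ (hQ.simpleReflection_nonneg hx h0 hm.1) fun h => ?_
    · rwa [cartanForm_simpleReflection]
    · exact hm.2 _ h (simpleReflection_simpleReflection i x)

lemma IsReducedWordOfLongest.isReducedWord {w : List I} (hw : IsReducedWordOfLongest w) :
    IsReducedWord w := isReducedWord_of_weylLength hw.1

/-- Suppose w α_j ≥ 0 and let u be a shortest word for w s_j, which is not longer than w. As u α_j =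
−w α_j is not nonnegative, the exchange condition gives a word for u s_j = w that is shorter than u,
against reducedness. -/
lemma IsReducedWordOfLongest.wordProd_single_nonpos (hQ : IsDynkinQuiver I)
    {w : List I} (hw : IsReducedWordOfLongest w)
    (j : I) : wordProd w (Pi.single j 1) ≤ 0 := by
  refine (hQ.nonneg_or_nonpos (by rw [cartanForm_wordProd, cartanForm_single_single,
    quiverCartan_self])).resolve_left fun h0 => ?_
  have hpos : (0 : I → ℤ) ≤ Pi.single j 1 := by simp
  obtain ⟨u, hu, hu'⟩ := exists_word_length_eq (w ++ [j])
  have hlen : u.length ≤ w.length := by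
    rw [hu, ← hw.1]
    exact hw.2 _
  have hws : wordProd (w ++ [j]) = wordProd w * simpleReflection j := by
    rw [wordProd_append]
    rfl
  obtain ⟨v, hv, hv'⟩ := hQ.exchange u j (fun h => by
    rw [hu', hws, Module.End.mul_apply, simpleReflection_single, map_neg] at h
    have hz : wordProd w (Pi.single j 1) = 0 := le_antisymm (neg_nonneg.1 h) h0
    have := cartanForm_wordProd w (Pi.single j 1) (Pi.single j 1)
    rw [hz, cartanForm_single_single, quiverCartan_self] at this
    simp at this)
  have := hw.isReducedWord v (by
    rw [hv', hu', hws, mul_assoc, simpleReflection_mul_self, mul_one])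
  omega

/-- Every positive root occurs among the roots of a reduced word of the longest element. -/
lemma IsReducedWordOfLongest.mem_wordRoots (hQ : IsDynkinQuiver I)
    {w : List I} (hw : IsReducedWordOfLongest w)
    {x : I → ℤ} (hx : cartanForm I x x = 2) (h0 : 0 ≤ x) : x ∈ wordRoots w := by
  by_contra hm
  -- The vector y = w⁻¹ x is a nonnegative combination of simple roots, and w makes each of them
  -- nonpositive. So x = w y is both nonnegative and nonpositive.
  have hy := hQ.wordProd_reverse_nonneg w hx h0 hm
  set y := wordProd w.reverse x with hydef
  have hxy : x = wordProd w y := by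
    rw [hydef, ← Module.End.mul_apply, wordProd_mul_reverse, Module.End.one_apply]
  have hle : wordProd w y ≤ 0 := by
    rw [pi_eq_sum_univ' y, map_sum]
    refine Finset.sum_nonpos fun i _ => ?_
    rw [map_smul]
    exact smul_nonpos_of_nonneg_of_nonpos (hy i) (hw.wordProd_single_nonpos hQ i)
  rw [← hxy] at hle
  have hz : x = 0 := le_antisymm hle h0
  rw [hz] at hx
  simp at hx

lemma IsReducedWordOfLongest.exists_wordRoot (hQ : IsDynkinQuiver I)
    {w : List I} (hw : IsReducedWordOfLongest w)
    {x : I → ℤ} (hx : cartanForm I x x = 2) (h0 : 0 ≤ x) : ∃ k, x = wordRoot w k :=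
  exists_wordRoot_eq (hw.mem_wordRoots hQ hx h0)

lemma IsReducedWord.wordRoot_injective (hQ : IsDynkinQuiver I)
    {w : List I} (hw : IsReducedWord w) :
    Function.Injective (wordRoot w) := by
  intro k l h
  rw [wordRoot_eq_getElem, wordRoot_eq_getElem] at h
  exact Fin.ext (((hw.nodup_wordRoots hQ).getElem_inj_iff).1 h)

/-! ### The Euler form of an adapted word -/

lemma IsOrientation.cartanForm_eq {Ω : I → I → Prop} (h : IsOrientation Ω) (x y : I → ℤ) :
    cartanForm I x y = orientedForm Ω x y + orientedForm Ω y x := by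
  simp only [cartanForm, orientedForm, orientedMatrix, Matrix.toBilin'_apply, of_apply]
  rw [Finset.sum_comm (f := fun i j => y i * _ * x j), ← Finset.sum_add_distrib]
  refine Finset.sum_congr rfl fun i _ => ?_
  rw [← Finset.sum_add_distrib]
  refine Finset.sum_congr rfl fun j _ => ?_
  by_cases hij : i = j
  · subst hij
    simp [h.irrefl, quiverCartan_self]
    ring
  · rw [quiverCartan_symm j i, if_neg hij, if_neg (Ne.symm hij)]
    by_cases h0 : quiverCartan I i j = 0
    · simp [h0]
    · rcases h.total i j hij h0 with h1 | h1
      · simp [h1, h.asymm _ _ h1]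
      · simp [h1, h.asymm _ _ h1]
        ring

lemma orientedForm_single_left {Ω : I → I → Prop} {i : I} (hi : ∀ j, ¬ Ω i j) (x : I → ℤ) :
    orientedForm Ω (Pi.single i 1) x = x i := by
  rw [orientedForm, Matrix.toBilin'_apply', single_one_dotProduct]
  simp [orientedMatrix, mulVec, dotProduct, hi]

lemma orientedForm_single_right {Ω : I → I → Prop} {i : I} (hi : ∀ j, ¬ Ω j i) (x : I → ℤ) :
    orientedForm Ω x (Pi.single i 1) = x i := by
  rw [orientedForm, Matrix.toBilin'_apply']
  simp [orientedMatrix, dotProduct, hi]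

/-- The part of the Euler form that does not change when arrows at the sink `i` are reversed. -/
lemma IsOrientation.orientedForm_sub_reverseAt {Ω : I → I → Prop} (h : IsOrientation Ω) {i : I}
    (hi : ∀ j, ¬ Ω i j) (x y : I → ℤ) :
    orientedForm Ω x y - orientedForm (_root_.reverseAt i Ω) x y =
      cartanForm I (Pi.single i 1) x * y i - x i * cartanForm I (Pi.single i 1) y := by
  -- Away from i the two forms agree (`hrest`), so only pairings with α_i matter. As i is a sink of
  -- Ω and a source after the reversal, one slot of each form just reads the coordinate i; the other
  -- slot follows from the symmetrization.
  have hsplit : ∀ z : I → ℤ, z = z i • Pi.single i 1 + Function.update z i 0 := by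
    intro z
    ext j
    by_cases hj : j = i
    · subst hj
      simp
    · simp [hj]
  have hrest : ∀ a b : I → ℤ, orientedForm Ω (Function.update a i 0) (Function.update b i 0) =
      orientedForm (_root_.reverseAt i Ω) (Function.update a i 0) (Function.update b i 0) := by
    intro a b
    simp only [orientedForm, orientedMatrix, Matrix.toBilin'_apply, of_apply]
    refine Finset.sum_congr rfl fun j _ => Finset.sum_congr rfl fun k _ => ?_
    by_cases hj : j = i
    · simp [hj]
    · by_cases hk : k = i
      · simp [hk]
      · have : _root_.reverseAt i Ω j k = Ω j k := by simp [_root_.reverseAt, hj, hk]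
        rw [this]
  have hsrc : ∀ j, ¬ _root_.reverseAt i Ω j i := by
    intro j
    simp [_root_.reverseAt, hi]
  have e1 : ∀ z, orientedForm Ω z (Pi.single i 1) =
      cartanForm I (Pi.single i 1) z - z i := by
    intro z
    rw [h.cartanForm_eq, orientedForm_single_left hi]
    ring
  have e2 : ∀ z, orientedForm (_root_.reverseAt i Ω) (Pi.single i 1) z =
      cartanForm I (Pi.single i 1) z - z i := by
    intro z
    rw [(h.reverseAt i).cartanForm_eq, orientedForm_single_right hsrc]
    ring
  have hx := hsplit x
  have hy := hsplit y
  have hr := hrest x y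
  have cx : cartanForm I (Pi.single i 1) x =
      2 * x i + cartanForm I (Pi.single i 1) (Function.update x i 0) := by
    conv_lhs => rw [hx]
    simp only [map_add, map_smul, smul_eq_mul, cartanForm_single_single, quiverCartan_self]
    ring
  have cy : cartanForm I (Pi.single i 1) y =
      2 * y i + cartanForm I (Pi.single i 1) (Function.update y i 0) := by
    conv_lhs => rw [hy]
    simp only [map_add, map_smul, smul_eq_mul, cartanForm_single_single, quiverCartan_self]
    ring
  rw [cx, cy]
  conv_lhs => rw [hx, hy]
  simp only [map_add, LinearMap.add_apply, map_smul, LinearMap.smul_apply, smul_eq_mul,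
    orientedForm_single_left hi, orientedForm_single_right hsrc, e1, e2, hr]
  simp
  ring

/-- The Euler form is invariant under the reflection at a sink. -/
lemma IsOrientation.orientedForm_reverseAt {Ω : I → I → Prop} (h : IsOrientation Ω) {i : I}
    (hi : ∀ j, ¬ Ω i j) (x y : I → ℤ) :
    orientedForm Ω (simpleReflection i x) (simpleReflection i y) =
      orientedForm (_root_.reverseAt i Ω) x y := by
  have key := h.orientedForm_sub_reverseAt hi x y
  have e1 : ∀ z, orientedForm Ω z (Pi.single i 1) =
      cartanForm I (Pi.single i 1) z - z i := by
    intro z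
    rw [h.cartanForm_eq, orientedForm_single_left hi]
    ring
  have e3 : (Pi.single i 1 : I → ℤ) i = 1 := by simp
  simp only [simpleReflection_apply, map_sub, LinearMap.sub_apply, map_smul, LinearMap.smul_apply,
    smul_eq_mul, orientedForm_single_left hi, e1, e3]
  linarith

/-- Reflection invariance reduces pairs in the tail to the shorter word and the reversed
orientation. For the first root α_i and a later root s_i y it gives ⟨s_i y, α_i⟩ = ⟨y, −α_i⟩ in the
reversed orientation. There i is a source, so the value is −y_i ≤ 0. -/
lemma IsAdaptedTo.pairwise_orientedForm (hQ : IsDynkinQuiver I) {Ω : I → I → Prop}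
    (h : IsOrientation Ω) {w : List I} (hw : IsReducedWord w) (ha : IsAdaptedTo Ω w) :
    (wordRoots w).Pairwise fun β γ => orientedForm Ω γ β ≤ 0 := by
  induction w generalizing Ω with
  | nil => exact List.Pairwise.nil
  | cons i w ih =>
    have hw' : IsReducedWord w := hw.of_append_right (u := [i])
    refine List.pairwise_cons.2 ⟨fun x hx => ?_, ?_⟩
    · obtain ⟨y, hy, rfl⟩ := List.mem_map.1 hx
      have e := h.orientedForm_reverseAt ha.1 y (-Pi.single i 1)
      have hsrc : ∀ j, ¬ reverseAt i Ω j i := by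
        intro j
        have := ha.1 j
        simp [reverseAt, this]
      rw [map_neg, simpleReflection_single, neg_neg, map_neg,
        orientedForm_single_right hsrc] at e
      rw [e]
      exact neg_nonpos.2 (hw'.nonneg_of_mem hQ hy i)
    · refine List.pairwise_map.2 ((ih (h.reverseAt i) hw' ha.2).imp fun {β γ} hβ => ?_)
      rwa [h.orientedForm_reverseAt ha.1]

/-- For i ≠ j the Euler form at α_i + α_j is 2 minus the number of edges, and it is positive. -/
lemma IsDynkinQuiver.card_hom_le (hQ : IsDynkinQuiver I) {i j : I} :
    Nat.card (i ⟶ j) + Nat.card (j ⟶ i) ≤ 1 := by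
  by_cases hij : i = j
  · subst hij
    have : IsEmpty (i ⟶ i) := hQ.no_loops i
    simp
  have hne : (Pi.single i 1 + Pi.single j 1 : I → ℤ) ≠ 0 := by
    intro h
    have := congrFun h i
    simp [hij] at this
  have h1 := hQ.eulerForm_pos hne
  have h2 := hQ.cartanForm_eq (Pi.single i 1 + Pi.single j 1) (Pi.single i 1 + Pi.single j 1)
  simp only [map_add, LinearMap.add_apply, cartanForm_single_single, quiverCartan_self,
    quiverCartan_symm j i] at h1 h2
  simp only [quiverCartan, of_apply, if_neg hij] at h2
  omega

lemma IsDynkinQuiver.card_hom_eq (hQ : IsDynkinQuiver I) (i j : I) :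
    (Nat.card (i ⟶ j) = 1 ∧ Nonempty (i ⟶ j) ∧ ¬ Nonempty (j ⟶ i) ∧ i ≠ j) ∨
      (Nat.card (i ⟶ j) = 0 ∧ ¬ Nonempty (i ⟶ j)) := by
  have := hQ.finite_arrows i j
  have := hQ.finite_arrows j i
  have hle := hQ.card_hom_le (i := i) (j := j)
  by_cases h : Nonempty (i ⟶ j)
  · left
    have hp : 0 < Nat.card (i ⟶ j) := Nat.card_pos
    refine ⟨by omega, h, fun h' => ?_, ?_⟩
    · have : 0 < Nat.card (j ⟶ i) := Nat.card_pos
      omega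
    · rintro rfl
      exact (hQ.no_loops i).false h.some
  · right
    refine ⟨?_, h⟩
    have := not_nonempty_iff.1 h
    simp

lemma IsDynkinQuiver.isOrientation (hQ : IsDynkinQuiver I) :
    IsOrientation fun i j : I => Nonempty (i ⟶ j) where
  irrefl i h := (hQ.no_loops i).false h.some
  total i j hij h0 := by
    rcases hQ.card_hom_eq i j with h | h
    · exact Or.inl h.2.1
    · rcases hQ.card_hom_eq j i with h' | h'
      · exact Or.inr h'.2.1
      · simp [quiverCartan, hij, h.1, h'.1] at h0
  asymm i j h := by
    rcases hQ.card_hom_eq i j with h' | h'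
    · exact h'.2.2.1
    · exact absurd h h'.2

lemma IsDynkinQuiver.orientedForm_eq (hQ : IsDynkinQuiver I) :
    orientedForm (fun i j : I => Nonempty (i ⟶ j)) = eulerForm I := by
  refine congrArg Matrix.toBilin' ?_
  ext i j
  simp only [orientedMatrix, of_apply]
  rcases hQ.card_hom_eq i j with h | h
  · have := not_nonempty_iff.1 h.2.2.1
    simp [h.1, h.2.1, h.2.2.2, quiverCartan]
  · simp [h.1, h.2]

/-- The Euler form is nonpositive on pairs of roots of an adapted word, the later root first. -/
lemma IsAdaptedWord.eulerForm_wordRoot_nonpos (hQ : IsDynkinQuiver I)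
    {w : List I} (ha : IsAdaptedWord w)
    (hw : IsReducedWord w) {k l : Fin w.length} (hkl : k < l) :
    eulerForm I (wordRoot w l) (wordRoot w k) ≤ 0 := by
  have := IsAdaptedTo.pairwise_orientedForm hQ hQ.isOrientation hw ha
  rw [hQ.orientedForm_eq, List.pairwise_iff_getElem] at this
  rw [wordRoot_eq_getElem, wordRoot_eq_getElem]
  exact this k l _ _ hkl

lemma IsReducedWordOfLongest.isPositiveRoot_iff (hQ : IsDynkinQuiver I)
    {w : List I} (hw : IsReducedWordOfLongest w)
    {x : I → ℤ} : IsPositiveRoot x ↔ ∃ k, x = wordRoot w k := by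
  constructor
  · rintro ⟨h0, u, i, rfl⟩
    refine hw.exists_wordRoot hQ ?_ h0
    rw [cartanForm_wordProd, cartanForm_single_single, quiverCartan_self]
  · rintro ⟨k, rfl⟩
    exact ⟨hw.isReducedWord.nonneg_of_mem hQ (wordRoot_mem w k), _, _, rfl⟩

end Roots

namespace QuiverRep

/-! ### Homomorphisms and extensions of representations -/

section Hom

variable {I : Type u} [Quiver.{v} I]

/-- A representation is finite-dimensional. -/
class FinDim (M : QuiverRep I) : Prop where
  finite : ∀ i, FiniteDimensional ℂ (M.space i)

attribute [instance] FinDim.finite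

/-- The families of linear maps at the vertices. -/
abbrev VertexMaps (M N : QuiverRep I) : Type _ := ∀ i, M.space i →ₗ[ℂ] N.space i

/-- The families of linear maps along the arrows. -/
abbrev ArrowMaps (M N : QuiverRep I) : Type _ := ∀ i j, (i ⟶ j) → M.space i →ₗ[ℂ] N.space j

/-- The map whose kernel is `Hom(M, N)` and whose cokernel is `Ext¹(M, N)`. -/
def delta (M N : QuiverRep I) : VertexMaps M N →ₗ[ℂ] ArrowMaps M N where
  toFun f i j h := N.map h ∘ₗ f i - f j ∘ₗ M.map h
  map_add' f g := by
    ext i j h v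
    simp
    abel
  map_smul' c f := by
    ext i j h v
    simp [smul_sub]

/-- The space of homomorphisms of representations. -/
def Hom (M N : QuiverRep I) : Submodule ℂ (VertexMaps M N) := LinearMap.ker (delta M N)

/-- The dimension of the space of homomorphisms. -/
def homDim (M N : QuiverRep I) : ℕ := finrank ℂ (Hom M N)

/-- The vanishing of `Ext¹(M, N)`. -/
def ExtVanish (M N : QuiverRep I) : Prop := Function.Surjective (delta M N)

/-- The dimension vector. -/
def dimVec (M : QuiverRep I) : I → ℤ := fun i => (finrank ℂ (M.space i) : ℤ)

lemma hasDimVector_iff {M : QuiverRep I} {d : I → ℤ} :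
    M.HasDimVector d ↔ M.FinDim ∧ M.dimVec = d :=
  ⟨fun h => ⟨⟨fun i => (h i).1⟩, funext fun i => (h i).2⟩,
    fun h i => ⟨h.1.finite i, congrFun h.2 i⟩⟩

lemma delta_apply (M N : QuiverRep I) (f : VertexMaps M N) {i j : I} (h : i ⟶ j)
    (v : M.space i) : delta M N f i j h v = N.map h (f i v) - f j (M.map h v) := rfl

lemma mem_Hom {M N : QuiverRep I} {f : VertexMaps M N} :
    f ∈ Hom M N ↔ ∀ (i j : I) (h : i ⟶ j) (v : M.space i),
      f j (M.map h v) = N.map h (f i v) := by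
  constructor
  · intro hf i j h v
    have := congrArg (fun g : ArrowMaps M N => g i j h v) (LinearMap.mem_ker.1 hf)
    exact (sub_eq_zero.1 this).symm
  · intro hf
    refine LinearMap.mem_ker.2 ?_
    ext i j h v
    rw [delta_apply, hf, sub_self]
    rfl

/-- The identity homomorphism. -/
def idMap (M : QuiverRep I) : VertexMaps M M := fun _ => LinearMap.id

/-- The composition of families of maps at the vertices. -/
def comp {M N P : QuiverRep I} (g : VertexMaps N P) (f : VertexMaps M N) : VertexMaps M P :=
  fun i => g i ∘ₗ f i

@[simp] lemma comp_apply {M N P : QuiverRep I} (g : VertexMaps N P) (f : VertexMaps M N) (i : I)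
    (v : M.space i) : comp g f i v = g i (f i v) := rfl

lemma idMap_mem (M : QuiverRep I) : idMap M ∈ Hom M M := mem_Hom.2 fun _ _ _ _ => rfl

lemma comp_mem {M N P : QuiverRep I} {g : VertexMaps N P} {f : VertexMaps M N}
    (hg : g ∈ Hom N P) (hf : f ∈ Hom M N) : comp g f ∈ Hom M P := mem_Hom.2 fun i j h v => by
  rw [comp_apply, comp_apply, mem_Hom.1 hf, mem_Hom.1 hg]

/-- Composition with `g` on the left, as a linear map. -/
def postcomp (X : QuiverRep I) {M N : QuiverRep I} (g : VertexMaps M N) :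
    VertexMaps X M →ₗ[ℂ] VertexMaps X N where
  toFun f := comp g f
  map_add' f f' := by ext i v; simp
  map_smul' c f := by ext i v; simp

/-- Composition with `g` on the right, as a linear map. -/
def precomp (X : QuiverRep I) {M N : QuiverRep I} (g : VertexMaps M N) :
    VertexMaps N X →ₗ[ℂ] VertexMaps M X where
  toFun f := comp f g
  map_add' f f' := by ext i v; simp
  map_smul' c f := by ext i v; simp

/-- The map `Hom(X, M) → Hom(X, N)` induced by a homomorphism `M → N`. -/
def homPost (X : QuiverRep I) {M N : QuiverRep I} {g : VertexMaps M N} (hg : g ∈ Hom M N) :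
    Hom X M →ₗ[ℂ] Hom X N :=
  (postcomp X g).restrict fun _ hf => comp_mem hg hf

/-- The map `Hom(N, X) → Hom(M, X)` induced by a homomorphism `M → N`. -/
def homPre (X : QuiverRep I) {M N : QuiverRep I} {g : VertexMaps M N} (hg : g ∈ Hom M N) :
    Hom N X →ₗ[ℂ] Hom M X :=
  (precomp X g).restrict fun _ hf => comp_mem hf hg

/-- Right exactness of Ext¹(M, ·): a cocycle is any family of linear maps, so it lifts along linear
sections of g at the vertices, which need not form a homomorphism. -/
lemma ExtVanish.of_surjective {M N N' : QuiverRep I} (h : ExtVanish M N) {g : VertexMaps N N'}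
    (hg : g ∈ Hom N N') (hs : ∀ i, Function.Surjective (g i)) : ExtVanish M N' := by
  intro c
  choose s hs using fun i => (g i).exists_rightInverse_of_surjective
    (LinearMap.range_eq_top.2 (hs i))
  obtain ⟨b, hb⟩ := h fun i j a => s j ∘ₗ c i j a
  refine ⟨comp g b, ?_⟩
  ext i j a v
  have := congrArg (fun c' : ArrowMaps M N => g j (c' i j a v)) hb
  simp only [delta_apply, map_sub] at this
  rw [delta_apply, comp_apply, comp_apply, ← mem_Hom.1 hg, this]
  exact LinearMap.congr_fun (hs j) _

/-- Dually, a cocycle on M' extends to M along linear retractions at the vertices. -/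
lemma ExtVanish.of_injective {M M' N : QuiverRep I} (h : ExtVanish M N) {g : VertexMaps M' M}
    (hg : g ∈ Hom M' M) (hi : ∀ i, Function.Injective (g i)) : ExtVanish M' N := by
  intro c
  choose s hs using fun i => (g i).exists_leftInverse_of_injective (LinearMap.ker_eq_bot.2 (hi i))
  obtain ⟨b, hb⟩ := h fun i j a => c i j a ∘ₗ s i
  refine ⟨comp b g, ?_⟩
  ext i j a v
  have := congrArg (fun c' : ArrowMaps M N => c' i j a (g i v)) hb
  simp only [delta_apply] at this
  rw [delta_apply, comp_apply, comp_apply, mem_Hom.1 hg, this]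
  exact congrArg (c i j a) (LinearMap.congr_fun (hs i) v)

lemma isIso_iff {M N : QuiverRep I} :
    IsIso M N ↔ ∃ f ∈ Hom M N, ∀ i, Function.Bijective (f i) := by
  constructor
  · rintro ⟨e, he⟩
    exact ⟨fun i => e i, mem_Hom.2 he, fun i => (e i).bijective⟩
  · rintro ⟨f, hf, hb⟩
    exact ⟨fun i => LinearEquiv.ofBijective (f i) (hb i), mem_Hom.1 hf⟩

lemma IsIso.refl (M : QuiverRep I) : IsIso M M :=
  ⟨fun _ => LinearEquiv.refl _ _, fun _ _ _ _ => rfl⟩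

lemma IsIso.symm {M N : QuiverRep I} (h : IsIso M N) : IsIso N M := by
  obtain ⟨e, he⟩ := h
  refine ⟨fun i => (e i).symm, fun i j a v => ?_⟩
  rw [LinearEquiv.symm_apply_eq, he, LinearEquiv.apply_symm_apply]

lemma IsIso.trans {M N P : QuiverRep I} (h : IsIso M N) (h' : IsIso N P) : IsIso M P := by
  obtain ⟨e, he⟩ := h
  obtain ⟨f, hf⟩ := h'
  exact ⟨fun i => (e i).trans (f i), fun i j a v => by simp [he, hf]⟩

lemma IsIso.dimVec_eq {M N : QuiverRep I} (h : IsIso M N) : M.dimVec = N.dimVec := by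
  obtain ⟨e, -⟩ := h
  exact funext fun i => by rw [dimVec, dimVec, (e i).finrank_eq]

lemma IsIso.finDim {M N : QuiverRep I} (h : IsIso M N) [M.FinDim] : N.FinDim := by
  obtain ⟨e, -⟩ := h
  exact ⟨fun i => (e i).finiteDimensional⟩

lemma IsIso.extVanish {M N M' N' : QuiverRep I} (h : IsIso M M') (h' : IsIso N N')
    (hE : ExtVanish M N) : ExtVanish M' N' := by
  obtain ⟨f, hf, hfb⟩ := isIso_iff.1 h.symm
  obtain ⟨g, hg, hgb⟩ := isIso_iff.1 h'
  exact (hE.of_injective hf fun i => (hfb i).1).of_surjective hg fun i => (hgb i).2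

/-- The total dimension. -/
def totalDim [Fintype I] (M : QuiverRep I) : ℕ := ∑ i, finrank ℂ (M.space i)

section FiniteQuiver

variable [Fintype I]

lemma homDim_le_of_injective (X : QuiverRep I) {M N : QuiverRep I} [X.FinDim] [N.FinDim]
    {g : VertexMaps M N} (hg : g ∈ Hom M N) (hi : ∀ i, Function.Injective (g i)) :
    homDim X M ≤ homDim X N :=
  LinearMap.finrank_le_finrank_of_injective (f := homPost X hg) fun a b hab => by
    ext i v
    exact hi i (congrArg (fun c : Hom X N => c.1 i v) hab)

lemma homDim_le_of_surjective (X : QuiverRep I) {M N : QuiverRep I} [X.FinDim] [M.FinDim]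
    {g : VertexMaps M N} (hg : g ∈ Hom M N) (hs : ∀ i, Function.Surjective (g i)) :
    homDim N X ≤ homDim M X :=
  LinearMap.finrank_le_finrank_of_injective (f := homPre X hg) fun a b hab => by
    ext i v
    obtain ⟨w, rfl⟩ := hs i v
    exact congrArg (fun c : Hom M X => c.1 i w) hab

lemma IsIso.homDim_eq {M N M' N' : QuiverRep I} [M.FinDim] [N.FinDim] (h : IsIso M M')
    (h' : IsIso N N') : homDim M N = homDim M' N' := by
  have := h.finDim
  have := h'.finDim
  obtain ⟨f, hf, hfb⟩ := isIso_iff.1 h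
  obtain ⟨g, hg, hgb⟩ := isIso_iff.1 h'
  obtain ⟨f', hf', hfb'⟩ := isIso_iff.1 h.symm
  obtain ⟨g', hg', hgb'⟩ := isIso_iff.1 h'.symm
  exact le_antisymm
    ((homDim_le_of_injective M hg fun i => (hgb i).1).trans
      (homDim_le_of_surjective N' hf' fun i => (hfb' i).2))
    ((homDim_le_of_injective M' hg' fun i => (hgb' i).1).trans
      (homDim_le_of_surjective N hf fun i => (hfb i).2))

lemma homDim_pos {M N : QuiverRep I} [M.FinDim] [N.FinDim] {f : VertexMaps M N} (hf : f ∈ Hom M N)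
    (h0 : f ≠ 0) : 0 < homDim M N := by
  have : Nontrivial (Hom M N) := ⟨⟨⟨f, hf⟩, 0, fun h => h0 (congrArg Subtype.val h)⟩⟩
  exact finrank_pos

/-! ### The Euler form of representations -/

variable [DecidableEq I]

lemma eulerForm_dimVec [∀ i j : I, Finite (i ⟶ j)] (M N : QuiverRep I) [M.FinDim] [N.FinDim] :
    eulerForm I M.dimVec N.dimVec =
      (finrank ℂ (VertexMaps M N) : ℤ) - finrank ℂ (ArrowMaps M N) := by
  classical
  have := fun i j : I => Fintype.ofFinite (i ⟶ j)
  have h1 : (finrank ℂ (VertexMaps M N) : ℤ) = ∑ i, M.dimVec i * N.dimVec i := by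
    rw [finrank_pi_fintype, Nat.cast_sum]
    refine Finset.sum_congr rfl fun i _ => ?_
    rw [finrank_linearMap, Nat.cast_mul]
    rfl
  have h2 : (finrank ℂ (ArrowMaps M N) : ℤ) =
      ∑ i, ∑ j, M.dimVec i * (Nat.card (i ⟶ j) : ℤ) * N.dimVec j := by
    rw [finrank_pi_fintype, Nat.cast_sum]
    refine Finset.sum_congr rfl fun i _ => ?_
    rw [finrank_pi_fintype, Nat.cast_sum]
    refine Finset.sum_congr rfl fun j _ => ?_
    rw [finrank_pi_fintype, Finset.sum_const, finrank_linearMap, Finset.card_univ,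
      Nat.card_eq_fintype_card]
    simp only [dimVec, smul_eq_mul, Nat.cast_mul]
    ring
  rw [h1, h2, eulerForm, Matrix.toBilin'_apply, ← Finset.sum_sub_distrib]
  refine Finset.sum_congr rfl fun i _ => ?_
  simp only [Matrix.of_apply, mul_sub, sub_mul, Finset.sum_sub_distrib]
  simp

variable [∀ i j : I, Finite (i ⟶ j)]

/-- The bracket is dim Ext¹(M, N); this is rank–nullity for `delta`. -/
lemma homDim_sub_eulerForm (M N : QuiverRep I) [M.FinDim] [N.FinDim] :
    (homDim M N : ℤ) = eulerForm I M.dimVec N.dimVec +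
      ((finrank ℂ (ArrowMaps M N) : ℤ) - finrank ℂ (LinearMap.range (delta M N))) := by
  have h := LinearMap.finrank_range_add_finrank_ker (delta M N)
  rw [eulerForm_dimVec]
  change _ + homDim M N = _ at h
  omega

lemma ExtVanish.homDim_eq {M N : QuiverRep I} [M.FinDim] [N.FinDim] (h : ExtVanish M N) :
    (homDim M N : ℤ) = eulerForm I M.dimVec N.dimVec := by
  rw [homDim_sub_eulerForm, LinearMap.range_eq_top.2 h, finrank_top]
  omega

lemma extVanish_of_homDim_le {M N : QuiverRep I} [M.FinDim] [N.FinDim]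
    (h : (homDim M N : ℤ) ≤ eulerForm I M.dimVec N.dimVec) : ExtVanish M N := by
  have h1 := homDim_sub_eulerForm M N
  have h2 : finrank ℂ (LinearMap.range (delta M N)) ≤ finrank ℂ (ArrowMaps M N) :=
    Submodule.finrank_le _
  exact LinearMap.range_eq_top.1 (Submodule.eq_top_of_finrank_eq (by omega))

end FiniteQuiver

end Hom

end QuiverRep

namespace QuiverRep

/-! ### Subrepresentations and direct sums -/

section DirectSums

variable {I : Type u} [Quiver.{v} I]

/-- A subrepresentation as a representation. -/
def sub (M : QuiverRep I) (U : ∀ i, Submodule ℂ (M.space i)) (hU : M.IsSubrep U) :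
    QuiverRep I where
  space i := U i
  map {i j} h := (M.map h).restrict (hU i j h)

instance sub.finDim (M : QuiverRep I) [M.FinDim] (U : ∀ i, Submodule ℂ (M.space i))
    (hU : M.IsSubrep U) : (M.sub U hU).FinDim :=
  ⟨fun i => inferInstanceAs (FiniteDimensional ℂ (U i))⟩

/-- The inclusion of a subrepresentation. -/
def subIncl (M : QuiverRep I) (U : ∀ i, Submodule ℂ (M.space i)) (hU : M.IsSubrep U) :
    VertexMaps (M.sub U hU) M := fun i => (U i).subtype

lemma subIncl_mem (M : QuiverRep I) (U : ∀ i, Submodule ℂ (M.space i)) (hU : M.IsSubrep U) :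
    subIncl M U hU ∈ Hom (M.sub U hU) M := mem_Hom.2 fun _ _ _ _ => rfl

lemma subIncl_injective (M : QuiverRep I) (U : ∀ i, Submodule ℂ (M.space i))
    (hU : M.IsSubrep U) (i : I) : Function.Injective (subIncl M U hU i) :=
  Subtype.val_injective

lemma isSubrep_ker {M N : QuiverRep I} {f : VertexMaps M N} (hf : f ∈ Hom M N) :
    M.IsSubrep fun i => LinearMap.ker (f i) := fun i j h v hv => by
  rw [LinearMap.mem_ker] at hv ⊢
  rw [mem_Hom.1 hf, hv, map_zero]

lemma isSubrep_range {M N : QuiverRep I} {f : VertexMaps M N} (hf : f ∈ Hom M N) :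
    N.IsSubrep fun i => LinearMap.range (f i) := by
  rintro i j h _ ⟨w, rfl⟩
  exact ⟨M.map h w, mem_Hom.1 hf i j h w⟩

/-- The surjection of a representation onto the image of a homomorphism. -/
def toRange {M N : QuiverRep I} {f : VertexMaps M N} (hf : f ∈ Hom M N) :
    VertexMaps M (N.sub _ (isSubrep_range hf)) := fun i => (f i).rangeRestrict

lemma toRange_mem {M N : QuiverRep I} {f : VertexMaps M N} (hf : f ∈ Hom M N) :
    toRange hf ∈ Hom M (N.sub _ (isSubrep_range hf)) :=
  mem_Hom.2 fun i j h v => Subtype.ext (mem_Hom.1 hf i j h v)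

lemma toRange_surjective {M N : QuiverRep I} {f : VertexMaps M N} (hf : f ∈ Hom M N) (i : I) :
    Function.Surjective (toRange hf i) := (f i).surjective_rangeRestrict

/-- The direct sum of a family of representations. -/
def pi {ι : Type} (M : ι → QuiverRep I) : QuiverRep I where
  space i := ∀ k, (M k).space i
  map h := LinearMap.piMap fun k => (M k).map h

section Pi

variable {ι : Type} (M : ι → QuiverRep I)

/-- The projection of a direct sum to a summand. -/
def piProj (k : ι) : VertexMaps (pi M) (M k) :=
  fun i => LinearMap.proj (φ := fun k => (M k).space i) k

lemma piProj_mem (k : ι) : piProj M k ∈ Hom (pi M) (M k) := mem_Hom.2 fun _ _ _ _ => rfl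

lemma piProj_surjective (k : ι) (i : I) : Function.Surjective (piProj M k i) :=
  LinearMap.proj_surjective (φ := fun k => (M k).space i) k

/-- The inclusion of a summand into a direct sum. -/
def piSingle [DecidableEq ι] (k : ι) : VertexMaps (M k) (pi M) :=
  fun i => LinearMap.single ℂ (fun k => (M k).space i) k

lemma piSingle_mem [DecidableEq ι] (k : ι) : piSingle M k ∈ Hom (M k) (pi M) :=
  mem_Hom.2 fun i j h v => by
    funext l
    refine (Pi.apply_single (fun l => (M l).map h) (fun l => map_zero _) k v l).symm

lemma piSingle_injective [DecidableEq ι] (k : ι) (i : I) :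
    Function.Injective (piSingle M k i) :=
  Pi.single_injective (M := fun k => (M k).space i) k

variable [Fintype ι]

instance pi.finDim [∀ k, (M k).FinDim] : (pi M).FinDim :=
  ⟨fun i => inferInstanceAs (FiniteDimensional ℂ (∀ k, (M k).space i))⟩

lemma sum_piSingle_piProj [DecidableEq ι] (i : I) (v : (pi M).space i) :
    ∑ k, piSingle M k i (piProj M k i v) = v :=
  Finset.univ_sum_single (M := fun k => (M k).space i) v

lemma dimVec_pi [∀ k, (M k).FinDim] : (pi M).dimVec = ∑ k, (M k).dimVec := by
  ext i
  rw [Finset.sum_apply]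
  have : finrank ℂ ((pi M).space i) = ∑ k, finrank ℂ ((M k).space i) :=
    finrank_pi_fintype ℂ (M := fun k => (M k).space i)
  rw [dimVec, this, Nat.cast_sum]
  rfl

lemma delta_comp_right {X Y Z : QuiverRep I} (b : VertexMaps Y Z) {f : VertexMaps X Y}
    (hf : f ∈ Hom X Y) {i j : I} (h : i ⟶ j) (v : X.space i) :
    delta X Z (comp b f) i j h v = delta Y Z b i j h (f i v) := by
  rw [delta_apply, delta_apply, comp_apply, comp_apply, mem_Hom.1 hf]

lemma delta_comp_left {X Y Z : QuiverRep I} {f : VertexMaps Y Z} (hf : f ∈ Hom Y Z)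
    (b : VertexMaps X Y) {i j : I} (h : i ⟶ j) (v : X.space i) :
    delta X Z (comp f b) i j h v = f j (delta X Y b i j h v) := by
  rw [delta_apply, delta_apply, comp_apply, comp_apply, map_sub, mem_Hom.1 hf]

variable {M}

lemma extVanish_pi_left {Y : QuiverRep I} (h : ∀ k, ExtVanish (M k) Y) : ExtVanish (pi M) Y := by
  classical
  intro c
  choose b hb using fun k => h k fun i j a => c i j a ∘ₗ piSingle M k i
  refine ⟨∑ k, comp (b k) (piProj M k), ?_⟩
  ext i j a v
  rw [map_sum]
  simp only [Finset.sum_apply, LinearMap.sum_apply, delta_comp_right _ (piProj_mem M _), hb,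
    LinearMap.comp_apply]
  rw [← map_sum, sum_piSingle_piProj]

lemma extVanish_pi_right {X : QuiverRep I} (h : ∀ k, ExtVanish X (M k)) : ExtVanish X (pi M) := by
  classical
  intro c
  choose b hb using fun k => h k fun i j a => piProj M k j ∘ₗ c i j a
  refine ⟨∑ k, comp (piSingle M k) (b k), ?_⟩
  ext i j a v
  rw [map_sum]
  simp only [Finset.sum_apply, LinearMap.sum_apply, delta_comp_left (piSingle_mem M _), hb,
    LinearMap.comp_apply]
  rw [sum_piSingle_piProj]

variable (M)

/-- `Hom(X, ⨁ M_k) = ∏ Hom(X, M_k)`. -/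
def homPiRight (X : QuiverRep I) : Hom X (pi M) ≃ₗ[ℂ] ∀ k, Hom X (M k) where
  toFun f k := homPost X (piProj_mem M k) f
  map_add' _ _ := funext fun _ => map_add _ _ _
  map_smul' _ _ := funext fun _ => map_smul _ _ _
  invFun g := ⟨fun i => LinearMap.pi fun k => (g k).1 i, mem_Hom.2 fun i j h v =>
    funext fun k => mem_Hom.1 (g k).2 i j h v⟩
  left_inv _ := rfl
  right_inv _ := rfl

/-- `Hom(⨁ M_k, X) = ∏ Hom(M_k, X)`. -/
def homPiLeft [DecidableEq ι] (X : QuiverRep I) : Hom (pi M) X ≃ₗ[ℂ] ∀ k, Hom (M k) X where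
  toFun f k := homPre X (piSingle_mem M k) f
  map_add' _ _ := funext fun _ => map_add _ _ _
  map_smul' _ _ := funext fun _ => map_smul _ _ _
  invFun g := ∑ k, homPre X (piProj_mem M k) (g k)
  left_inv f := by
    ext i v
    rw [AddSubmonoidClass.coe_finsetSum, Finset.sum_apply, LinearMap.sum_apply]
    change ∑ k, f.1 i (piSingle M k i (piProj M k i v)) = _
    rw [← map_sum, sum_piSingle_piProj]
  right_inv g := by
    ext l i v
    change ((∑ k, homPre X (piProj_mem M k) (g k) : Hom (pi M) X) : VertexMaps (pi M) X) i
      (piSingle M l i v) = _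
    rw [AddSubmonoidClass.coe_finsetSum, Finset.sum_apply, LinearMap.sum_apply]
    change ∑ k, (g k).1 i (Pi.single (M := fun k => (M k).space i) l v k) = _
    rw [Finset.sum_eq_single l (fun k _ hk => by rw [Pi.single_eq_of_ne hk, map_zero])
      (fun h => absurd (Finset.mem_univ l) h), Pi.single_eq_same]

variable [Fintype I] [∀ k, (M k).FinDim]

lemma homDim_pi_right (X : QuiverRep I) [X.FinDim] :
    homDim X (pi M) = ∑ k, homDim X (M k) := by
  rw [homDim, (homPiRight M X).finrank_eq, finrank_pi_fintype]
  rfl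

lemma homDim_pi_left (X : QuiverRep I) [X.FinDim] :
    homDim (pi M) X = ∑ k, homDim (M k) X := by
  classical
  rw [homDim, (homPiLeft M X).finrank_eq, finrank_pi_fintype]
  rfl

end Pi

/-! ### Decomposition into indecomposables -/

lemma isIso_pi_sum {ι κ : Type} {M A B : QuiverRep I} {N : ι → QuiverRep I} {P : κ → QuiverRep I}
    (hA : IsIso A (pi N)) (hB : IsIso B (pi P))
    {f : VertexMaps A M} (hf : f ∈ Hom A M) {g : VertexMaps B M} (hg : g ∈ Hom B M)
    (hfg : ∀ i, Function.Bijective fun x : A.space i × B.space i => f i x.1 + g i x.2) :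
    IsIso M (pi (Sum.elim N P)) := by
  obtain ⟨a, ha⟩ := hA.symm
  obtain ⟨b, hb⟩ := hB.symm
  refine IsIso.symm (isIso_iff.2 ⟨fun i =>
    (f i ∘ₗ (a i).toLinearMap ∘ₗ (LinearMap.pi fun k =>
      LinearMap.proj (φ := fun s => (Sum.elim N P s).space i) (Sum.inl k) :
        (pi (Sum.elim N P)).space i →ₗ[ℂ] (pi N).space i)) +
    (g i ∘ₗ (b i).toLinearMap ∘ₗ (LinearMap.pi fun k =>
      LinearMap.proj (φ := fun s => (Sum.elim N P s).space i) (Sum.inr k) :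
        (pi (Sum.elim N P)).space i →ₗ[ℂ] (pi P).space i)), ?_, fun i => ?_⟩)
  · refine mem_Hom.2 fun i j h v => ?_
    rw [LinearMap.add_apply, LinearMap.add_apply, map_add]
    exact congrArg₂ (· + ·)
      ((congrArg (f j) (ha i j h fun k => v (Sum.inl k))).trans (mem_Hom.1 hf i j h _))
      ((congrArg (g j) (hb i j h fun k => v (Sum.inr k))).trans (mem_Hom.1 hg i j h _))
  · let e : (∀ s, (Sum.elim N P s).space i) ≃ A.space i × B.space i :=
      (LinearEquiv.sumPiEquivProdPi ℂ ι κ fun s => (Sum.elim N P s).space i).toEquiv.trans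
        ((a i).toEquiv.prodCongr (b i).toEquiv)
    exact (hfg i).comp e.bijective

variable [Fintype I]

lemma totalDim_sub_lt {M : QuiverRep I} [M.FinDim] {U : ∀ i, Submodule ℂ (M.space i)}
    (hU : M.IsSubrep U) (h : ∃ i, U i ≠ ⊤) : (M.sub U hU).totalDim < M.totalDim := by
  obtain ⟨i, hi⟩ := h
  exact Finset.sum_lt_sum (fun j _ => Submodule.finrank_le (U j))
    ⟨i, Finset.mem_univ i, Submodule.finrank_lt hi⟩

theorem exists_decomposition (M : QuiverRep I) [M.FinDim] :
    ∃ (ι : Type) (_ : Fintype ι) (N : ι → QuiverRep I),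
      (∀ k, (N k).IsIndecomposable) ∧ (∀ k, (N k).FinDim) ∧ IsIso M (pi N) := by
  induction hn : M.totalDim using Nat.strong_induction_on generalizing M with
  | _ n ih =>
    by_cases h0 : ∃ i, Nontrivial (M.space i)
    · by_cases hind : M.IsIndecomposable
      · refine ⟨Unit, inferInstance, fun _ => M, fun _ => hind, fun _ => inferInstance, ?_⟩
        exact ⟨fun i => (LinearEquiv.funUnique Unit ℂ (M.space i)).symm, fun _ _ _ _ => rfl⟩
      · simp only [IsIndecomposable, not_and, not_forall, not_or] at hind
        obtain ⟨U, W, hU, hW, hc, hU0, hW0⟩ := hind h0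
        have hUt : ∃ i, U i ≠ ⊤ := by
          obtain ⟨i, hi⟩ := hW0
          refine ⟨i, fun h => hi ?_⟩
          have := (hc i).disjoint
          rw [h] at this
          exact this.eq_bot_of_ge le_top
        have hWt : ∃ i, W i ≠ ⊤ := by
          obtain ⟨i, hi⟩ := hU0
          refine ⟨i, fun h => hi ?_⟩
          have := (hc i).disjoint
          rw [h] at this
          exact this.eq_bot_of_le le_top
        obtain ⟨ι, _, N, hN, hN', hMN⟩ := ih _ (hn ▸ totalDim_sub_lt hU hUt) (M.sub U hU) rfl
        obtain ⟨κ, _, P, hP, hP', hMP⟩ := ih _ (hn ▸ totalDim_sub_lt hW hWt) (M.sub W hW) rfl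
        refine ⟨ι ⊕ κ, inferInstance, Sum.elim N P, ?_, ?_,
          isIso_pi_sum hMN hMP (subIncl_mem M U hU) (subIncl_mem M W hW) fun i =>
            (Submodule.prodEquivOfIsCompl (U i) (W i) (hc i)).bijective⟩
        · rintro (k | k)
          exacts [hN k, hP k]
        · rintro (k | k)
          exacts [hN' k, hP' k]
    · simp only [not_exists, not_nontrivial_iff_subsingleton] at h0
      refine ⟨Empty, inferInstance, Empty.elim, fun k => k.elim, fun k => k.elim,
        isIso_iff.2 ⟨0, Submodule.zero_mem _, fun i => ⟨fun a b _ => ?_, fun a => ⟨0, ?_⟩⟩⟩⟩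
      · exact (h0 i).elim a b
      · exact funext fun k => k.elim

/-! ### Extension of homomorphisms -/

omit [Fintype I] in
/-- If `Ext¹(Y, Z) = 0` and `K` is the kernel of `X → Y`, every map `K → Z` extends to `X`. -/
lemma exists_extension {K X Y Z : QuiverRep I} {τ : VertexMaps K X} (hτ : τ ∈ Hom K X)
    (hi : ∀ i, Function.Injective (τ i)) {p : VertexMaps X Y} (hp : p ∈ Hom X Y)
    (hs : ∀ i, Function.Surjective (p i))
    (hker : ∀ i x, p i x = 0 → x ∈ LinearMap.range (τ i)) (hE : ExtVanish Y Z)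
    {π : VertexMaps K Z} (hπ : π ∈ Hom K Z) (hpτ : ∀ i x, p i (τ i x) = 0) :
    ∃ ρ ∈ Hom X Z, ∀ i x, ρ i (τ i x) = π i x := by
  choose t ht using fun i =>
    (τ i).exists_leftInverse_of_injective (LinearMap.ker_eq_bot.2 (hi i))
  choose s hs' using fun i =>
    (p i).exists_rightInverse_of_surjective (LinearMap.range_eq_top.2 (hs i))
  have hts : ∀ i x, t i (τ i x) = x := fun i x => LinearMap.congr_fun (ht i) x
  have hps : ∀ i y, p i (s i y) = y := fun i y => LinearMap.congr_fun (hs' i) y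
  have hτt : ∀ i x, τ i (t i (x - s i (p i x))) = x - s i (p i x) := by
    intro i x
    obtain ⟨k, hk⟩ := hker i (x - s i (p i x)) (by rw [map_sub, hps, sub_self])
    rw [← hk, hts]
  -- The section s fails to be a homomorphism by a cocycle with values in the image of K. Its image
  -- under π is a coboundary of some b, which corrects the linear extension π t (1 − s p) by b p.
  obtain ⟨b, hb⟩ := hE fun i j h => π j ∘ₗ t j ∘ₗ (X.map h ∘ₗ s i - s j ∘ₗ Y.map h)
  refine ⟨fun i => π i ∘ₗ t i ∘ₗ (LinearMap.id - s i ∘ₗ p i) + b i ∘ₗ p i,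
    mem_Hom.2 fun i j h x => ?_, fun i x => by simp [hpτ, hts]⟩
  have h1 := congrArg (fun c : ArrowMaps Y Z => c i j h (p i x)) hb
  have h2 : π j (K.map h (t i (x - s i (p i x)))) = π j (t j (X.map h (x - s i (p i x)))) := by
    rw [← hts j (K.map h _), mem_Hom.1 hτ, hτt]
  simp only [delta_apply, LinearMap.comp_apply, LinearMap.sub_apply, map_sub] at h1 h2
  simp only [LinearMap.add_apply, LinearMap.comp_apply, LinearMap.sub_apply, LinearMap.id_apply,
    map_add, map_sub, ← mem_Hom.1 hπ, mem_Hom.1 hp]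
  linear_combination (norm := module) -h1 - h2

end DirectSums

end QuiverRep

namespace QuiverRep

/-! ### Indecomposable representations are bricks -/

section Bricks

lemma eq_zero_of_finrank_range_le {U V W : Type*} [AddCommGroup U] [Module ℂ U]
    [AddCommGroup V] [Module ℂ V] [AddCommGroup W] [Module ℂ W] [FiniteDimensional ℂ U]
    {f : U →ₗ[ℂ] V} {g : V →ₗ[ℂ] W}
    (h : finrank ℂ (LinearMap.range f) ≤ finrank ℂ (LinearMap.range (g ∘ₗ f)))
    {x : U} (hx : g (f x) = 0) : f x = 0 := by
  have h1 := LinearMap.finrank_range_add_finrank_ker (g.domRestrict (LinearMap.range f))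
  have h2 : LinearMap.range (g.domRestrict (LinearMap.range f)) = LinearMap.range (g ∘ₗ f) := by
    rw [LinearMap.range_domRestrict, LinearMap.range_comp]
  rw [h2] at h1
  have h3 : LinearMap.ker (g.domRestrict (LinearMap.range f)) = ⊥ :=
    Submodule.finrank_eq_zero.1 (by omega)
  have h4 : (⟨f x, x, rfl⟩ : LinearMap.range f) ∈
      LinearMap.ker (g.domRestrict (LinearMap.range f)) := hx
  rw [h3, Submodule.mem_bot] at h4
  exact congrArg Subtype.val h4

lemma isCompl_range_ker_of_leftInverse {V W : Type*} [AddCommGroup V] [Module ℂ V]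
    [AddCommGroup W] [Module ℂ W] {f : V →ₗ[ℂ] W} {g : W →ₗ[ℂ] V} (h : ∀ x, g (f x) = x) :
    IsCompl (LinearMap.range f) (LinearMap.ker g) := by
  refine ⟨Submodule.disjoint_def.2 ?_, codisjoint_iff.2 (eq_top_iff.2 fun x _ => ?_)⟩
  · rintro _ ⟨y, rfl⟩ hy
    rw [LinearMap.mem_ker, h] at hy
    rw [hy, map_zero]
  · refine Submodule.mem_sup.2 ⟨f (g x), ⟨g x, rfl⟩, x - f (g x), ?_, by abel⟩
    rw [LinearMap.mem_ker, map_sub, h, sub_self]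

variable {I : Type u} [Quiver.{v} I]

lemma dimVec_ne_zero {M : QuiverRep I} [M.FinDim] (h : ∃ i, Nontrivial (M.space i)) :
    M.dimVec ≠ 0 := fun h0 => by
  obtain ⟨i, hi⟩ := h
  have h1 : (finrank ℂ (M.space i) : ℤ) = 0 := congrFun h0 i
  have h2 : 0 < finrank ℂ (M.space i) := finrank_pos
  omega

/-- Subtract from a non-scalar endomorphism an eigenvalue of its component at a vertex where M does
not vanish; here ℂ being algebraically closed is used. -/
lemma exists_endomorphism_of_homDim_ne_one {M : QuiverRep I} [M.FinDim]
    (h0 : ∃ i, Nontrivial (M.space i)) (h : homDim M M ≠ 1) :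
    ∃ f ∈ Hom M M, f ≠ 0 ∧ ∃ i, ¬ Function.Injective (f i) := by
  obtain ⟨i, hi⟩ := h0
  have hid : (⟨idMap M, idMap_mem M⟩ : Hom M M) ≠ 0 := fun h => by
    obtain ⟨x, hx⟩ := exists_ne (0 : M.space i)
    exact hx (congrArg (fun f : Hom M M => f.1 i x) h)
  have hne := (finrank_eq_one_iff_of_nonzero' _ hid).not.1 h
  push Not at hne
  obtain ⟨f, hf⟩ := hne
  obtain ⟨c, hc⟩ := Module.End.exists_eigenvalue (f.1 i : Module.End ℂ (M.space i))
  obtain ⟨x, hx⟩ := hc.exists_hasEigenvector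
  have hfx : f.1 i x = c • x := hx.apply_eq_smul
  refine ⟨f.1 - c • idMap M, sub_mem f.2 (Submodule.smul_mem _ _ (idMap_mem M)),
    fun h' => hf c (Subtype.ext (sub_eq_zero.1 h').symm), i, fun hinj => hx.2 (hinj ?_)⟩
  rw [map_zero]
  change f.1 i x - c • x = 0
  rw [hfx, sub_self]

variable [Fintype I]

/-- The sum of the ranks of a family of maps at the vertices. -/
def rank {M N : QuiverRep I} (f : VertexMaps M N) : ℕ :=
  ∑ i, finrank ℂ (LinearMap.range (f i))

lemma totalDim_le_of_injective {M N : QuiverRep I} [N.FinDim] (f : VertexMaps M N)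
    (h : ∀ i, Function.Injective (f i)) : M.totalDim ≤ N.totalDim :=
  Finset.sum_le_sum fun i _ => LinearMap.finrank_le_finrank_of_injective (h i)

/-- If `g ∘ f` does not have smaller rank than `f`, then `g` is injective on the image of `f`. -/
lemma eq_zero_of_rank_le {M N P : QuiverRep I} [M.FinDim] {f : VertexMaps M N}
    {g : VertexMaps N P} (h : rank f ≤ rank (comp g f)) {i : I} {x : M.space i}
    (hx : g i (f i x) = 0) : f i x = 0 := by
  have hle : ∀ i ∈ Finset.univ, finrank ℂ (LinearMap.range (comp g f i)) ≤
      finrank ℂ (LinearMap.range (f i)) := fun i _ => by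
    rw [comp, LinearMap.range_comp]
    exact Submodule.finrank_map_le _ _
  have := (Finset.sum_eq_sum_iff_of_le hle).1 (le_antisymm (Finset.sum_le_sum hle) h) i
    (Finset.mem_univ i)
  exact eq_zero_of_finrank_range_le this.ge hx

/-- A nonzero nilpotent endomorphism of an indecomposable representation that is not a brick. -/
lemma IsIndecomposable.exists_square_zero {M : QuiverRep I} [M.FinDim] (hM : M.IsIndecomposable)
    (h : homDim M M ≠ 1) :
    ∃ θ ∈ Hom M M, θ ≠ 0 ∧ comp θ θ = 0 ∧ ∀ f ∈ Hom M M, f ≠ 0 → rank θ ≤ rank f := by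
  obtain ⟨g, hg, hg0, i₀, hgi⟩ := exists_endomorphism_of_homDim_ne_one hM.1 h
  obtain ⟨θ, ⟨hθ, hθ0⟩, hmin⟩ := (measure (rank (M := M) (N := M))).wf.has_min
    {f | f ∈ Hom M M ∧ f ≠ 0} ⟨g, hg, hg0⟩
  have hmin' : ∀ f ∈ Hom M M, f ≠ 0 → rank θ ≤ rank f := fun f hf hf0 =>
    not_lt.1 (hmin f ⟨hf, hf0⟩)
  refine ⟨θ, hθ, hθ0, ?_, hmin'⟩
  -- If θ² ≠ 0, minimality gives rank θ² = rank θ, hence M = ker θ ⊕ im θ. Indecomposability leaves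
  -- θ = 0, or θ injective and so of larger rank than the non-injective g.
  by_contra hsq
  have hr := hmin' _ (comp_mem hθ hθ) hsq
  have hc : ∀ i, IsCompl (LinearMap.ker (θ i)) (LinearMap.range (θ i)) := by
    intro i
    refine (Submodule.isCompl_iff_disjoint _ _ ?_).2 (Submodule.disjoint_def.2 ?_)
    · rw [add_comm, LinearMap.finrank_range_add_finrank_ker]
    · rintro _ hx ⟨y, rfl⟩
      exact eq_zero_of_rank_le hr hx
  rcases hM.2 _ _ (isSubrep_ker hθ) (isSubrep_range hθ) hc with hk | hk
  · have h1 : rank θ = M.totalDim := Finset.sum_congr rfl fun i _ =>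
      LinearMap.finrank_range_of_inj (LinearMap.ker_eq_bot.1 (hk i))
    have h2 : rank g < M.totalDim := by
      refine Finset.sum_lt_sum (fun i _ => LinearMap.finrank_range_le _)
        ⟨i₀, Finset.mem_univ _, lt_of_le_of_ne (LinearMap.finrank_range_le _) fun he => hgi ?_⟩
      rw [← LinearMap.ker_eq_bot]
      have := LinearMap.finrank_range_add_finrank_ker (g i₀)
      exact Submodule.finrank_eq_zero.1 (by omega)
    have h3 := hmin' g hg hg0
    omega
  · exact hθ0 (funext fun i => LinearMap.range_eq_bot.1 (hk i))

variable [DecidableEq I]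

/-- An indecomposable representation of a Dynkin quiver has only scalar endomorphisms and no
self-extensions. -/
theorem IsIndecomposable.homDim_self_eq_one_and_extVanish (hQ : IsDynkinQuiver I)
    {M : QuiverRep I} [M.FinDim] (hM : M.IsIndecomposable) :
    homDim M M = 1 ∧ ExtVanish M M := by
  classical
  have hfin := hQ.finite_arrows
  induction hn : M.totalDim using Nat.strong_induction_on generalizing M with
  | _ n ih =>
    -- Since ⟨dim M, dim M⟩ ≥ 1, dim End M = 1 leaves no room for Ext¹(M, M).
    suffices h : homDim M M = 1 by
      refine ⟨h, extVanish_of_homDim_le ?_⟩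
      have := hQ.eulerForm_pos (dimVec_ne_zero hM.1)
      rw [h]
      push_cast
      omega
    by_contra h
    obtain ⟨θ, hθ, hθ0, hsq, hmin⟩ := hM.exists_square_zero h
    have hθθ : ∀ i x, θ i (θ i x) = 0 := fun i x =>
      congrArg (fun f : VertexMaps M M => f i x) hsq
    set K := M.sub _ (isSubrep_ker hθ) with hK
    have hKlt : K.totalDim < M.totalDim := totalDim_sub_lt _ (by
      by_contra! hall
      exact hθ0 (funext fun i => LinearMap.ker_eq_top.1 (hall i)))
    obtain ⟨ι, _, N, hN, hNf, hiso⟩ := exists_decomposition K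
    obtain ⟨e, he⟩ := hiso
    have heH : (fun i => (e i : K.space i →ₗ[ℂ] (pi N).space i)) ∈ Hom K (pi N) := mem_Hom.2 he
    have heH' : (fun i => ((e i).symm : (pi N).space i →ₗ[ℂ] K.space i)) ∈ Hom (pi N) K :=
      mem_Hom.2 fun i j a v => by
        simp only [LinearEquiv.coe_coe]
        rw [LinearEquiv.symm_apply_eq, he, LinearEquiv.apply_symm_apply]
    let θK : VertexMaps M K := fun i => (θ i).codRestrict (LinearMap.ker (θ i)) (hθθ i)
    have hθK : θK ∈ Hom M K := mem_Hom.2 fun i j a v => Subtype.ext (mem_Hom.1 hθ i j a v)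
    have hrK : rank θK = rank θ := Finset.sum_congr rfl fun i _ => by
      have : LinearMap.range (θ i) = (LinearMap.range (θK i)).map (LinearMap.ker (θ i)).subtype :=
        (LinearMap.range_comp (θK i) (LinearMap.ker (θ i)).subtype).symm ▸ rfl
      rw [this]
      exact (Submodule.finrank_map_subtype_eq _ _).symm
    let π : ∀ k, VertexMaps K (N k) := fun k => comp (piProj N k) fun i => (e i).toLinearMap
    let τ : ∀ k, VertexMaps (N k) K := fun k =>
      comp (fun i => (e i).symm.toLinearMap) (piSingle N k)
    have hπ : ∀ k, π k ∈ Hom K (N k) := fun k => comp_mem (piProj_mem N k) heH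
    have hτ : ∀ k, τ k ∈ Hom (N k) K := fun k => comp_mem heH' (piSingle_mem N k)
    have hτi : ∀ k i, Function.Injective (τ k i) := fun k i =>
      (e i).symm.injective.comp (piSingle_injective N k i)
    have hπτ : ∀ k i x, π k i (τ k i x) = x := fun k i x => by
      change (e i ((e i).symm (piSingle N k i x))) k = x
      rw [LinearEquiv.apply_symm_apply]
      exact Pi.single_eq_same (M := fun k => (N k).space i) k x
    -- As θ² = 0, the image of θ lies in K = ker θ. Some indecomposable summand N_a of K receives a
    -- nonzero component of it.
    obtain ⟨a, ha⟩ : ∃ a, comp (π a) θK ≠ 0 := by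
      by_contra! hall
      refine hθ0 (funext fun i => LinearMap.ext fun x => ?_)
      have h1 : e i (θK i x) = 0 := funext fun k =>
        congrArg (fun f : VertexMaps M (N k) => f i x) (hall k)
      exact congrArg Subtype.val ((LinearEquiv.map_eq_zero_iff (e i)).1 h1)
    set T : VertexMaps (N a) M := comp (subIncl M _ (isSubrep_ker hθ)) (τ a) with hTdef
    have hT : T ∈ Hom (N a) M := comp_mem (subIncl_mem M _ _) (hτ a)
    have hTi : ∀ i, Function.Injective (T i) := fun i =>
      (subIncl_injective M _ _ i).comp (hτi a i)
    have hψ0 : comp (comp T (π a)) θK ≠ 0 := fun h0 => ha (by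
      refine funext fun i => LinearMap.ext fun x => hTi i ?_
      rw [Pi.zero_apply, LinearMap.zero_apply, map_zero]
      exact congrArg (fun f : VertexMaps M M => f i x) h0)
    -- Following θ by the projection to N_a and its inclusion into M gives a nonzero endomorphism of
    -- M. By minimality of rank θ no rank is lost, so im θ embeds in N_a.
    have hr : rank θK ≤ rank (comp (comp T (π a)) θK) :=
      hrK.trans_le (hmin _ (comp_mem (comp_mem hT (hπ a)) hθK) hψ0)
    have hNlt : (N a).totalDim < n :=
      hn ▸ (totalDim_le_of_injective (τ a) (hτi a)).trans_lt hKlt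
    let κ : VertexMaps (M.sub _ (isSubrep_range hθ)) K := fun i =>
      Submodule.inclusion (by rintro _ ⟨x, rfl⟩; exact hθθ i x)
    have hκ : κ ∈ Hom (M.sub _ (isSubrep_range hθ)) K := mem_Hom.2 fun _ _ _ _ => rfl
    -- By induction N_a has no self-extensions, and this passes to im θ ⊆ N_a in the first argument.
    have hE : ExtVanish (M.sub _ (isSubrep_range hθ)) (N a) := by
      refine (ih _ hNlt (hN a) rfl).2.of_injective (comp_mem (hπ a) hκ) fun i => ?_
      refine (injective_iff_map_eq_zero _).2 ?_
      rintro ⟨_, x, rfl⟩ hx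
      have h1 : comp T (π a) i (θK i x) = 0 := (congrArg (T i) hx).trans (map_zero _)
      have h2 : θ i x = 0 := congrArg Subtype.val (eq_zero_of_rank_le hr h1)
      exact Subtype.ext h2
    -- In 0 → ker θ → M → im θ → 0 the projection ker θ → N_a now extends to M. So N_a, a nonzero
    -- representation smaller than M, is a direct summand of M, which is impossible.
    obtain ⟨ρ, hρ, hρπ⟩ := exists_extension (subIncl_mem M _ (isSubrep_ker hθ))
      (subIncl_injective M _ _) (toRange_mem hθ) (toRange_surjective hθ)
      (fun i x hx => ⟨⟨x, congrArg Subtype.val hx⟩, rfl⟩) hE (hπ a)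
      (fun i x => Subtype.ext x.2)
    have hρT : ∀ i x, ρ i (T i x) = x := fun i x => (hρπ i _).trans (hπτ a i x)
    rcases hM.2 _ _ (isSubrep_range hT) (isSubrep_ker hρ)
      (fun i => isCompl_range_ker_of_leftInverse (hρT i)) with h0 | h0
    · obtain ⟨i, hi⟩ := (hN a).1
      obtain ⟨x, hx⟩ := exists_ne (0 : (N a).space i)
      refine hx ?_
      rw [← hρT i x, LinearMap.range_eq_bot.1 (h0 i), LinearMap.zero_apply, map_zero]
    · have := totalDim_le_of_injective ρ fun i => LinearMap.ker_eq_bot.1 (h0 i)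
      omega

end Bricks

end QuiverRep

namespace QuiverRep

/-! ### Rigid representations -/

section Rigid

variable {I : Type u} [Quiver.{v} I]

/-- The extension of `B` by `A` given by a cocycle. -/
def extension (A B : QuiverRep I) (c : ArrowMaps B A) : QuiverRep I where
  space i := A.space i × B.space i
  map {i j} h := (A.map h ∘ₗ LinearMap.fst ℂ _ _ + c i j h ∘ₗ LinearMap.snd ℂ _ _).prod
    (B.map h ∘ₗ LinearMap.snd ℂ _ _)

variable {A B : QuiverRep I} (c : ArrowMaps B A)

instance extension.finDim [A.FinDim] [B.FinDim] : (extension A B c).FinDim :=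
  ⟨fun i => inferInstanceAs (FiniteDimensional ℂ (A.space i × B.space i))⟩

/-- The projection of an extension onto the quotient. -/
def extProj : VertexMaps (extension A B c) B := fun i => LinearMap.snd ℂ (A.space i) (B.space i)

lemma extProj_mem : extProj c ∈ Hom (extension A B c) B := mem_Hom.2 fun _ _ _ _ => rfl

/-- The inclusion of the subrepresentation into an extension. -/
def extIncl : VertexMaps A (extension A B c) := fun i => LinearMap.inl ℂ (A.space i) (B.space i)

lemma extIncl_mem : extIncl c ∈ Hom A (extension A B c) := mem_Hom.2 fun i j h v =>
  Prod.ext (show A.map h v = A.map h v + c i j h 0 by rw [map_zero, add_zero])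
    (show 0 = B.map h 0 from (map_zero _).symm)

lemma dimVec_extension [A.FinDim] [B.FinDim] :
    (extension A B c).dimVec = A.dimVec + B.dimVec := by
  ext i
  exact (congrArg Nat.cast (finrank_prod (R := ℂ) (M := A.space i) (M' := B.space i))).trans
    (Nat.cast_add _ _)

lemma exists_dimVec_eq (ν : I → ℕ) :
    ∃ M : QuiverRep I, M.FinDim ∧ M.dimVec = fun i => (ν i : ℤ) := by
  refine ⟨⟨fun i => Fin (ν i) → ℂ, fun _ => 0⟩, ⟨fun i => ?_⟩, funext fun i => ?_⟩
  · exact inferInstanceAs (FiniteDimensional ℂ (Fin (ν i) → ℂ))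
  · exact congrArg Nat.cast (finrank_fin_fun ℂ)

variable [Fintype I]

/-- Left exactness of Hom(X, ·): a map killed by the projection to B takes values in A. The rank is
kept so that a strict inequality can be read off later. -/
lemma homDim_extension_right_le_rank (X : QuiverRep I) [X.FinDim] [A.FinDim] [B.FinDim] :
    homDim X (extension A B c) ≤
      homDim X A + finrank ℂ (LinearMap.range (homPost X (extProj_mem c))) := by
  rw [homDim, ← LinearMap.finrank_range_add_finrank_ker (homPost X (extProj_mem c)), add_comm]
  refine Nat.add_le_add_right ?_ _
  have hker : ∀ (f : LinearMap.ker (homPost X (extProj_mem c))) (i : I) (x : X.space i),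
      (f.1.1 i x).2 = 0 := fun f i x =>
    congrArg (fun g : Hom X B => g.1 i x) (LinearMap.mem_ker.1 f.2)
  let φ : LinearMap.ker (homPost X (extProj_mem c)) →ₗ[ℂ] Hom X A :=
    { toFun := fun f => ⟨fun i => LinearMap.fst ℂ (A.space i) (B.space i) ∘ₗ f.1.1 i,
        mem_Hom.2 fun i j h x => by
          change (f.1.1 j (X.map h x)).1 = A.map h (f.1.1 i x).1
          rw [mem_Hom.1 f.1.2]
          change A.map h (f.1.1 i x).1 + c i j h (f.1.1 i x).2 = _
          rw [hker, map_zero, add_zero]⟩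
      map_add' := fun _ _ => rfl
      map_smul' := fun _ _ => rfl }
  refine LinearMap.finrank_le_finrank_of_injective (f := φ) fun f g hfg => ?_
  refine Subtype.ext (Subtype.ext (funext fun i => LinearMap.ext fun x => ?_))
  exact Prod.ext (congrArg (fun g : Hom X A => g.1 i x) hfg) ((hker f i x).trans (hker g i x).symm)

lemma homDim_extension_right_le (X : QuiverRep I) [X.FinDim] [A.FinDim] [B.FinDim] :
    homDim X (extension A B c) ≤ homDim X A + homDim X B :=
  (homDim_extension_right_le_rank c X).trans
    (Nat.add_le_add_left (Submodule.finrank_le _) _)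

/-- If the identity of B lifted to the extension, the A-component of the lift would exhibit c as a
coboundary. -/
lemma homDim_extension_right_lt [A.FinDim] [B.FinDim] (hc : c ∉ LinearMap.range (delta B A)) :
    homDim B (extension A B c) < homDim B A + homDim B B := by
  refine (homDim_extension_right_le_rank c B).trans_lt
    (Nat.add_lt_add_left (Submodule.finrank_lt fun h => hc ?_) _)
  obtain ⟨f, hf⟩ : (⟨idMap B, idMap_mem B⟩ : Hom B B) ∈
      LinearMap.range (homPost B (extProj_mem c)) := by rw [h]; trivial
  have h2 : ∀ i x, (f.1 i x).2 = x := fun i x => congrArg (fun g : Hom B B => g.1 i x) hf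
  refine ⟨-fun i => LinearMap.fst ℂ (A.space i) (B.space i) ∘ₗ f.1 i, ?_⟩
  ext i j h x
  have h3 : (f.1 j (B.map h x)).1 = A.map h (f.1 i x).1 + c i j h (f.1 i x).2 :=
    congrArg Prod.fst (mem_Hom.1 f.2 i j h x)
  rw [h2] at h3
  change A.map h (-(f.1 i x).1) - -(f.1 j (B.map h x)).1 = _
  rw [h3, map_neg]
  abel

lemma homDim_extension_left_le (Y : QuiverRep I) [Y.FinDim] [A.FinDim] [B.FinDim] :
    homDim (extension A B c) Y ≤ homDim A Y + homDim B Y := by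
  rw [homDim, ← LinearMap.finrank_range_add_finrank_ker (homPre Y (extIncl_mem c))]
  refine Nat.add_le_add (Submodule.finrank_le _) ?_
  have hker : ∀ (f : LinearMap.ker (homPre Y (extIncl_mem c))) (i : I) (x : A.space i),
      f.1.1 i (x, 0) = 0 := fun f i x =>
    congrArg (fun g : Hom A Y => g.1 i x) (LinearMap.mem_ker.1 f.2)
  have hsnd : ∀ (f : LinearMap.ker (homPre Y (extIncl_mem c))) (i : I) (a : A.space i)
      (b : B.space i), f.1.1 i (a, b) = f.1.1 i (0, b) := fun f i a b => by
    have : (a, b) = ((a, 0) + (0, b) : A.space i × B.space i) := by simp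
    refine (congrArg (f.1.1 i) this).trans ((map_add (f.1.1 i) _ _).trans ?_)
    exact (congrArg (· + _) (hker f i a)).trans (zero_add _)
  let φ : LinearMap.ker (homPre Y (extIncl_mem c)) →ₗ[ℂ] Hom B Y :=
    { toFun := fun f => ⟨fun i => f.1.1 i ∘ₗ LinearMap.inr ℂ (A.space i) (B.space i),
        mem_Hom.2 fun i j h x => by
          have h1 := mem_Hom.1 f.1.2 i j h (0, x)
          refine Eq.trans ?_ h1
          exact (hsnd f j _ (B.map h x)).symm⟩
      map_add' := fun _ _ => rfl
      map_smul' := fun _ _ => rfl }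
  refine LinearMap.finrank_le_finrank_of_injective (f := φ) fun f g hfg => ?_
  refine Subtype.ext (Subtype.ext (funext fun i => LinearMap.ext fun x => ?_))
  exact (hsnd f i x.1 x.2).trans ((congrArg (fun g : Hom B Y => g.1 i x.2) hfg).trans
    (hsnd g i x.1 x.2).symm)

variable [DecidableEq I]

/-- Every dimension vector of a Dynkin quiver is that of a rigid representation. -/
theorem exists_rigid (hQ : IsDynkinQuiver I) (ν : I → ℕ) :
    ∃ (ι : Type) (_ : Fintype ι) (N : ι → QuiverRep I),
      (∀ k, (N k).IsIndecomposable) ∧ (∀ k, (N k).FinDim) ∧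
      (pi N).dimVec = (fun i => (ν i : ℤ)) ∧ ∀ k l, ExtVanish (N k) (N l) := by
  classical
  have hfin := hQ.finite_arrows
  obtain ⟨M₀, hM₀, hM₀'⟩ := exists_dimVec_eq ν
  -- Rigidity is obtained by minimizing dim End M over all representations of dimension vector ν.
  obtain ⟨M, ⟨hM, hMν⟩, hmin⟩ := (measure fun M : QuiverRep I => homDim M M).wf.has_min
    {M | M.FinDim ∧ M.dimVec = fun i => (ν i : ℤ)} ⟨M₀, hM₀, hM₀'⟩
  obtain ⟨ι, _, N, hN, hNf, hiso⟩ := exists_decomposition M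
  refine ⟨ι, inferInstance, N, hN, hNf, hiso.dimVec_eq.symm.trans hMν, fun k l => ?_⟩
  rcases eq_or_ne l k with rfl | hkl
  · exact ((hN l).homDim_self_eq_one_and_extVanish hQ).2
  by_contra hE
  -- If Ext¹(N_k, N_l) ≠ 0, let A be the sum of all summands but N_k and E a nonsplit extension of
  -- N_k by A. Then dim End E ≤ hom(A, E) + hom(N_k, E) < dim End(A ⊕ N_k), where the strict
  -- inequality comes from Hom(N_k, ·).
  let A : QuiverRep I := pi fun s : {s // s ≠ k} => N s
  have hA : ¬ ExtVanish (N k) A := fun h => hE (h.of_surjective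
    (piProj_mem (fun s : {s // s ≠ k} => N s) ⟨l, hkl⟩)
    (piProj_surjective (fun s : {s // s ≠ k} => N s) ⟨l, hkl⟩))
  obtain ⟨c, hc⟩ : ∃ c, c ∉ LinearMap.range (delta (N k) A) := by
    by_contra! h
    exact hA h
  have hl : ∀ X : QuiverRep I, X.FinDim → homDim (pi N) X = homDim (N k) X + homDim A X :=
    fun X _ => by
      rw [homDim_pi_left, homDim_pi_left]
      exact Fintype.sum_eq_add_sum_subtype_ne _ k
  have hr : ∀ X : QuiverRep I, X.FinDim → homDim X (pi N) = homDim X (N k) + homDim X A :=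
    fun X _ => by
      rw [homDim_pi_right, homDim_pi_right]
      exact Fintype.sum_eq_add_sum_subtype_ne _ k
  have hd : (extension A (N k) c).dimVec = fun i => (ν i : ℤ) := by
    rw [← hMν, hiso.dimVec_eq, dimVec_extension, dimVec_pi, dimVec_pi,
      Fintype.sum_eq_add_sum_subtype_ne _ k, add_comm]
  refine hmin (extension A (N k) c) ⟨inferInstance, hd⟩ ?_
  change homDim _ _ < homDim M M
  rw [hiso.homDim_eq hiso, hl _ inferInstance, hr _ inferInstance, hr _ inferInstance]
  have h1 := homDim_extension_left_le c (extension A (N k) c)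
  have h2 := homDim_extension_right_le c A
  have h3 := homDim_extension_right_lt c hc
  omega

end Rigid

end QuiverRep

/-! ### Polynomial functions on the representation space -/

section PolynomialFunctions

variable {I : Type u} [Quiver.{v} I] {ν : I → ℕ}

/-- The algebra of polynomial functions on the representation space. -/
def polyFun (ν : I → ℕ) : Subalgebra ℂ (RepSpace ν → ℂ) :=
  (MvPolynomial.aeval fun (c : RepCoord ν) (x : RepSpace ν) => x.coord c).range

lemma mem_polyFun {φ : RepSpace ν → ℂ} :
    φ ∈ polyFun ν ↔ ∃ f : MvPolynomial (RepCoord ν) ℂ, ∀ x, φ x = MvPolynomial.eval x.coord f := by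
  have key : ∀ (f : MvPolynomial (RepCoord ν) ℂ) (x : RepSpace ν),
      MvPolynomial.aeval (fun (c : RepCoord ν) (x : RepSpace ν) => x.coord c) f x =
        MvPolynomial.eval x.coord f := by
    intro f x
    have := MvPolynomial.comp_aeval_apply (fun (c : RepCoord ν) (x : RepSpace ν) => x.coord c)
      (Pi.evalAlgHom ℂ (fun _ : RepSpace ν => ℂ) x) f
    exact this.trans (RingHom.congr_fun (MvPolynomial.coe_aeval_eq_eval x.coord) f)
  constructor
  · rintro ⟨f, rfl⟩
    exact ⟨f, key f⟩
  · rintro ⟨f, hf⟩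
    exact ⟨f, funext fun x => (key f x).trans (hf x).symm⟩

/-- The point with given coordinates. -/
def RepSpace.ofCoord (ν : I → ℕ) : (RepCoord ν → ℂ) →ₗ[ℂ] RepSpace ν where
  toFun a i j h := Matrix.of fun r s => a ⟨i, j, h, r, s⟩
  map_add' _ _ := rfl
  map_smul' _ _ := rfl

lemma RepSpace.ofCoord_coord (x : RepSpace ν) : RepSpace.ofCoord ν x.coord = x := rfl

lemma RepSpace.coord_ofCoord (a : RepCoord ν → ℂ) : (RepSpace.ofCoord ν a).coord = a := rfl

lemma const_mem_polyFun (c : ℂ) : (fun _ => c) ∈ polyFun ν := (polyFun ν).algebraMap_mem c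

/-- The representation space is irreducible. -/
lemma exists_ne_zero_of_polyFun {φ ψ : RepSpace ν → ℂ} (hφ : φ ∈ polyFun ν) (hψ : ψ ∈ polyFun ν)
    {x y : RepSpace ν} (hx : φ x ≠ 0) (hy : ψ y ≠ 0) : ∃ z, φ z ≠ 0 ∧ ψ z ≠ 0 := by
  obtain ⟨f, hf⟩ := mem_polyFun.1 hφ
  obtain ⟨g, hg⟩ := mem_polyFun.1 hψ
  have hf0 : f ≠ 0 := by
    rintro rfl
    exact hx (by rw [hf, map_zero])
  have hg0 : g ≠ 0 := by
    rintro rfl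
    exact hy (by rw [hg, map_zero])
  by_contra! h
  refine mul_ne_zero hf0 hg0 (MvPolynomial.funext fun a => ?_)
  have h1 := h (RepSpace.ofCoord ν a)
  rw [hf, hg, RepSpace.coord_ofCoord] at h1
  rw [map_mul, map_zero]
  by_cases h2 : MvPolynomial.eval a f = 0
  · rw [h2, zero_mul]
  · rw [h1 h2, mul_zero]

lemma linear_mem_polyFun [Finite I] [∀ i j : I, Finite (i ⟶ j)] (l : RepSpace ν →ₗ[ℂ] ℂ) :
    (l : RepSpace ν → ℂ) ∈ polyFun ν := by
  classical
  have := Fintype.ofFinite (RepCoord ν)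
  have h : (l : RepSpace ν → ℂ) =
      ∑ c, l (RepSpace.ofCoord ν fun d => if c = d then 1 else 0) • fun x => x.coord c := by
    ext x
    have := LinearMap.pi_apply_eq_sum_univ (l ∘ₗ RepSpace.ofCoord ν) x.coord
    rw [LinearMap.comp_apply, RepSpace.ofCoord_coord] at this
    rw [this, Finset.sum_apply]
    refine Finset.sum_congr rfl fun c _ => ?_
    rw [smul_eq_mul, mul_comm]
    rfl
  rw [h]
  refine Subalgebra.sum_mem _ fun c _ => Subalgebra.smul_mem _ ?_ _
  exact ⟨MvPolynomial.X c, MvPolynomial.aeval_X _ c⟩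

lemma det_mem_polyFun {n : Type*} [Fintype n] [DecidableEq n] {A : RepSpace ν → Matrix n n ℂ}
    (h : ∀ i j, (fun x => A x i j) ∈ polyFun ν) : (fun x => (A x).det) ∈ polyFun ν := by
  have : (fun x => (A x).det) =
      ∑ σ : Equiv.Perm n, ((Equiv.Perm.sign σ : ℤ) : ℂ) • ∏ i, fun x => A x (σ i) i := by
    ext x
    rw [Matrix.det_apply', Finset.sum_apply]
    refine Finset.sum_congr rfl fun σ _ => ?_
    rw [Pi.smul_apply, Finset.prod_apply, smul_eq_mul]
  rw [this]
  exact Subalgebra.sum_mem _ fun σ _ => Subalgebra.smul_mem _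
    (Subalgebra.prod_mem _ fun i _ => h _ _) _

lemma adjugate_mem_polyFun {n : Type*} [Fintype n] [DecidableEq n]
    {A : RepSpace ν → Matrix n n ℂ} (h : ∀ i j, (fun x => A x i j) ∈ polyFun ν) (i j : n) :
    (fun x => (A x).adjugate i j) ∈ polyFun ν := by
  simp only [Matrix.adjugate_apply]
  refine det_mem_polyFun fun a b => ?_
  by_cases ha : a = j
  · subst ha
    simp only [Matrix.updateRow_self]
    exact const_mem_polyFun _
  · simp only [Matrix.updateRow_ne ha]
    exact h a b

/-! ### Linear maps depending polynomially on the point -/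

variable {V W : Type*} [AddCommGroup V] [Module ℂ V] [AddCommGroup W] [Module ℂ W]

/-- A family of vectors with polynomial coordinates. -/
def IsPolyVector (s : RepSpace ν → V) : Prop :=
  ∀ l : V →ₗ[ℂ] ℂ, (fun y => l (s y)) ∈ polyFun ν

/-- A family of linear maps with polynomial matrix entries. -/
def IsPolyFamily (D : RepSpace ν → V →ₗ[ℂ] W) : Prop := ∀ v, IsPolyVector fun y => D y v

lemma IsPolyFamily.comp {U X : Type*} [AddCommGroup U] [Module ℂ U] [AddCommGroup X] [Module ℂ X]
    {D : RepSpace ν → V →ₗ[ℂ] W} (hD : IsPolyFamily D) (a : W →ₗ[ℂ] X) (b : U →ₗ[ℂ] V) :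
    IsPolyFamily fun y => a ∘ₗ D y ∘ₗ b := fun v l => hD (b v) (l ∘ₗ a)

lemma isPolyFamily_of_affine [Finite I] [∀ i j : I, Finite (i ⟶ j)] {D : RepSpace ν → V →ₗ[ℂ] W}
    (D₀ : V →ₗ[ℂ] W) (D₁ : RepSpace ν → V →ₗ[ℂ] W) (hD : ∀ y, D y = D₀ + D₁ y)
    (hadd : ∀ y z, D₁ (y + z) = D₁ y + D₁ z) (hsmul : ∀ (c : ℂ) y, D₁ (c • y) = c • D₁ y) :
    IsPolyFamily D := by
  intro v l
  let L : RepSpace ν →ₗ[ℂ] ℂ :=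
    { toFun := fun y => l (D₁ y v)
      map_add' := fun y z => by rw [hadd, LinearMap.add_apply, map_add]
      map_smul' := fun c y => by rw [hsmul, LinearMap.smul_apply, map_smul]; rfl }
  have : (fun y => l (D y v)) = (fun _ => l (D₀ v)) + (L : RepSpace ν → ℂ) := by
    ext y
    rw [hD, LinearMap.add_apply, map_add]
    rfl
  rw [this]
  exact Subalgebra.add_mem _ (const_mem_polyFun _) (linear_mem_polyFun L)

lemma IsPolyFamily.toMatrix_mem {n m : Type*} [Fintype n] [DecidableEq n] [Finite m]
    {D : RepSpace ν → V →ₗ[ℂ] W} (hD : IsPolyFamily D) (b : Basis n ℂ V) (b' : Basis m ℂ W)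
    (i : m) (j : n) : (fun y => LinearMap.toMatrix b b' (D y) i j) ∈ polyFun ν := by
  have := hD (b j) (b'.coord i)
  simpa [LinearMap.toMatrix_apply] using this

/-- The dimension of the kernel is upper semicontinuous. -/
lemma IsPolyFamily.exists_finrank_ker_le [FiniteDimensional ℂ V] [FiniteDimensional ℂ W]
    {D : RepSpace ν → V →ₗ[ℂ] W} (hD : IsPolyFamily D) (x : RepSpace ν) :
    ∃ φ ∈ polyFun ν, φ x ≠ 0 ∧ ∀ y, φ y ≠ 0 →
      finrank ℂ (LinearMap.ker (D y)) ≤ finrank ℂ (LinearMap.ker (D x)) := by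
  classical
  -- On a complement U of ker D_x the map D_x has a left inverse a. Where det(a D_y|_U) does not
  -- vanish, ker D_y still meets U trivially.
  obtain ⟨U, hU⟩ := Submodule.exists_isCompl (LinearMap.ker (D x))
  have hinj : LinearMap.ker (D x ∘ₗ U.subtype) = ⊥ := by
    refine LinearMap.ker_eq_bot'.2 fun u hu => ?_
    exact Subtype.ext (Submodule.disjoint_def.1 hU.disjoint u hu u.2)
  obtain ⟨a, ha⟩ := (D x ∘ₗ U.subtype).exists_leftInverse_of_injective hinj
  let b := finBasis ℂ U
  refine ⟨fun y => (LinearMap.toMatrix b b (a ∘ₗ D y ∘ₗ U.subtype)).det,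
    det_mem_polyFun fun i j => (hD.comp a U.subtype).toMatrix_mem b b i j, ?_, fun y hy => ?_⟩
  · change (LinearMap.toMatrix b b (a ∘ₗ D x ∘ₗ U.subtype)).det ≠ 0
    rw [ha, LinearMap.toMatrix_id, Matrix.det_one]
    exact one_ne_zero
  · have hd : Disjoint (LinearMap.ker (D y)) U := by
      refine Submodule.disjoint_def.2 fun u hu hU' => ?_
      have hu' : (a ∘ₗ D y ∘ₗ U.subtype) ⟨u, hU'⟩ = 0 :=
        (congrArg a (LinearMap.mem_ker.1 hu)).trans (map_zero a)
      beta_reduce at hy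
      rw [LinearMap.det_toMatrix] at hy
      have hk := (LinearMap.isUnit_iff_ker_eq_bot _).1
        ((LinearMap.isUnit_iff_isUnit_det _).2 (isUnit_iff_ne_zero.2 hy))
      exact congrArg Subtype.val ((LinearMap.ker_eq_bot'.1 hk) _ hu')
    have h1 := Submodule.finrank_add_finrank_le_of_disjoint hd
    have h2 := Submodule.finrank_add_eq_of_isCompl hU
    omega

/-- A kernel vector of a surjective member of a family extends to a polynomial family of kernel
vectors. -/
lemma IsPolyFamily.exists_kernel_vector [FiniteDimensional ℂ V] [FiniteDimensional ℂ W]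
    {D : RepSpace ν → V →ₗ[ℂ] W} (hD : IsPolyFamily D) {x : RepSpace ν}
    (hx : Function.Surjective (D x)) {v : V} (hv : D x v = 0) :
    ∃ s : RepSpace ν → V, IsPolyVector s ∧ s x = v ∧ ∀ y, D y (s y) = 0 := by
  classical
  obtain ⟨R, hR⟩ := (D x).exists_rightInverse_of_surjective (LinearMap.range_eq_top.2 hx)
  let b := finBasis ℂ W
  let A : RepSpace ν → Matrix _ _ ℂ := fun y => LinearMap.toMatrix b b (D y ∘ₗ R)
  have hA : ∀ i j, (fun y => A y i j) ∈ polyFun ν := fun i j =>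
    (hD.comp LinearMap.id R).toMatrix_mem b b i j
  have hAx : A x = 1 := by
    change LinearMap.toMatrix b b (D x ∘ₗ R) = 1
    rw [hR, LinearMap.toMatrix_id]
  -- Cramer's rule: with A = D_y R for a right inverse R of D_x, the vector det(A) v − R adj(A) D_y
  -- v lies in ker D_y without any division. At y = x it is v, because A = 1 and D_x v = 0.
  refine ⟨fun y => (A y).det • v - R (Matrix.toLin b b (A y).adjugate (D y v)), fun l => ?_, ?_,
    fun y => ?_⟩
  · have : (fun y => l ((A y).det • v - R (Matrix.toLin b b (A y).adjugate (D y v)))) =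
        (l v) • (fun y => (A y).det) - ∑ i, ∑ j, l (R (b i)) •
          ((fun y => (A y).adjugate i j) * fun y => b.coord j (D y v)) := by
      ext y
      simp only [map_sub, map_smul, Matrix.toLin_apply, map_sum, Matrix.mulVec, dotProduct,
        Finset.sum_smul, Pi.sub_apply, Pi.smul_apply, smul_eq_mul, Finset.sum_apply, Pi.mul_apply,
        Basis.coord_apply]
      rw [mul_comm]
      congr 1
      refine Finset.sum_congr rfl fun i _ => Finset.sum_congr rfl fun j _ => ?_
      ring
    rw [this]
    refine Subalgebra.sub_mem _ (Subalgebra.smul_mem _ (det_mem_polyFun hA) _)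
      (Subalgebra.sum_mem _ fun i _ => Subalgebra.sum_mem _ fun j _ => Subalgebra.smul_mem _
        (Subalgebra.mul_mem _ (adjugate_mem_polyFun hA i j) (hD v (b.coord j))) _)
  · simp only [hAx, hv, map_zero, Matrix.det_one, one_smul, sub_zero]
  · have h1 : D y ∘ₗ R = Matrix.toLin b b (A y) := (Matrix.toLin_toMatrix b b _).symm
    have h2 : D y (R (Matrix.toLin b b (A y).adjugate (D y v))) =
        (Matrix.toLin b b (A y) ∘ₗ Matrix.toLin b b (A y).adjugate) (D y v) := by
      rw [← h1]
      rfl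
    rw [map_sub, map_smul, h2, ← Matrix.toLin_mul, Matrix.mul_adjugate, map_smul,
      Matrix.toLin_one, LinearMap.smul_apply, LinearMap.id_apply, sub_self]

end PolynomialFunctions

/-! ### Orbits of rigid representations -/

section Orbits

open QuiverRep

variable {I : Type u} [Quiver.{v} I] {ν : I → ℕ}

instance RepSpace.toRep_finDim (x : RepSpace ν) : x.toRep.FinDim :=
  ⟨fun i => inferInstanceAs (FiniteDimensional ℂ (Fin (ν i) → ℂ))⟩

lemma mem_glOrbit_iff {x y : RepSpace ν} : y ∈ glOrbit x ↔ IsIso x.toRep y.toRep := by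
  constructor
  · rintro ⟨g, hg⟩
    refine ⟨fun i => Matrix.toLin'OfInv (M := (g i)⁻¹.1) (M' := (g i).1)
      (g i).inv_mul (g i).mul_inv,
      fun i j h v => ?_⟩
    suffices ∀ v : Fin (ν i) → ℂ,
        (g j).1.mulVec ((x h).mulVec v) = (y h).mulVec ((g i).1.mulVec v) from this v
    intro v
    rw [hg h, Matrix.mulVec_mulVec, Matrix.mulVec_mulVec]
    congr 1
    rw [Matrix.mul_assoc, ← Units.val_mul, inv_mul_cancel]
    simp
  · rintro ⟨e, he⟩
    let e' : ∀ i, (Fin (ν i) → ℂ) ≃ₗ[ℂ] (Fin (ν i) → ℂ) := e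
    let g : ∀ i, GL (Fin (ν i)) ℂ := fun i =>
      ⟨LinearMap.toMatrix' (e' i).toLinearMap, LinearMap.toMatrix' (e' i).symm.toLinearMap,
        by rw [← LinearMap.toMatrix'_comp, LinearEquiv.comp_symm, LinearMap.toMatrix'_id],
        by rw [← LinearMap.toMatrix'_comp, LinearEquiv.symm_comp, LinearMap.toMatrix'_id]⟩
    refine ⟨g, fun i j h => ?_⟩
    suffices hg : y h * (g i).1 = (g j).1 * x h by
      rw [← hg, Matrix.mul_assoc, ← Units.val_mul, mul_inv_cancel, Units.val_one, Matrix.mul_one]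
    apply Matrix.toLin'.injective
    refine LinearMap.ext fun v => ?_
    have := he i j h v
    rw [Matrix.toLin'_mul, Matrix.toLin'_mul]
    change Matrix.toLin' (y h) (Matrix.toLin' (LinearMap.toMatrix' (e' i).toLinearMap) v) =
      Matrix.toLin' (LinearMap.toMatrix' (e' j).toLinearMap) (Matrix.toLin' (x h) v)
    rw [Matrix.toLin'_toMatrix', Matrix.toLin'_toMatrix']
    exact this.symm

lemma mem_glOrbit_self (x : RepSpace ν) : x ∈ glOrbit x := mem_glOrbit_iff.2 (IsIso.refl _)

lemma glOrbit_eq_of_mem {x y : RepSpace ν} (h : y ∈ glOrbit x) : glOrbit y = glOrbit x := by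
  rw [mem_glOrbit_iff] at h
  ext z
  rw [mem_glOrbit_iff, mem_glOrbit_iff]
  exact ⟨h.trans, h.symm.trans⟩

lemma exists_isIso_toRep {M : QuiverRep I} [M.FinDim] (h : M.dimVec = fun i => (ν i : ℤ)) :
    ∃ x : RepSpace ν, IsIso x.toRep M := by
  have e : ∀ i, (Fin (ν i) → ℂ) ≃ₗ[ℂ] M.space i := fun i =>
    LinearEquiv.ofFinrankEq _ _ (by
      have : (finrank ℂ (M.space i) : ℤ) = ν i := congrFun h i
      rw [finrank_fin_fun]
      omega)
  refine ⟨fun i j a => LinearMap.toMatrix'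
    ((e j).symm.toLinearMap ∘ₗ M.map a ∘ₗ (e i).toLinearMap), e, fun i j a v => ?_⟩
  change e j (Matrix.toLin' (LinearMap.toMatrix' _) v) = _
  rw [Matrix.toLin'_toMatrix']
  exact (e j).apply_symm_apply _

/-- The map `delta` from a varying point of the representation space. -/
def deltaLeft (X : QuiverRep I) (y : RepSpace ν) :
    (∀ i, (Fin (ν i) → ℂ) →ₗ[ℂ] X.space i) →ₗ[ℂ]
      (∀ i j, (i ⟶ j) → (Fin (ν i) → ℂ) →ₗ[ℂ] X.space j) := delta y.toRep X

/-- The map `delta` to a varying point of the representation space. -/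
def deltaRight (X : QuiverRep I) (y : RepSpace ν) :
    (∀ i, X.space i →ₗ[ℂ] (Fin (ν i) → ℂ)) →ₗ[ℂ]
      (∀ i j, (i ⟶ j) → X.space i →ₗ[ℂ] (Fin (ν j) → ℂ)) := delta X y.toRep

variable [Finite I] [∀ i j : I, Finite (i ⟶ j)]

lemma isPolyFamily_deltaLeft (X : QuiverRep I) : IsPolyFamily (ν := ν) (deltaLeft X) := by
  refine isPolyFamily_of_affine
    { toFun := fun f i j h => X.map h ∘ₗ f i
      map_add' := fun f g => ?_
      map_smul' := fun c f => ?_ }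
    (fun y =>
    { toFun := fun f i j h => - f j ∘ₗ Matrix.mulVecLin (y h)
      map_add' := fun f g => ?_
      map_smul' := fun c f => ?_ }) (fun y => ?_) (fun y z => ?_) fun c y => ?_
  · ext i j h v
    simp
  · ext i j h v
    simp
  · ext i j h v
    simp
    abel
  · ext i j h v
    simp
  · refine LinearMap.ext fun f => ?_
    funext i j h
    refine LinearMap.ext fun v => ?_
    exact sub_eq_add_neg _ _
  · refine LinearMap.ext fun f => ?_
    funext i j h
    refine LinearMap.ext fun v => ?_
    change -f j ((y h + z h).mulVec v) = -f j ((y h).mulVec v) + -f j ((z h).mulVec v)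
    rw [Matrix.add_mulVec, map_add, neg_add]
  · refine LinearMap.ext fun f => ?_
    funext i j h
    refine LinearMap.ext fun v => ?_
    change -f j ((c • y h).mulVec v) = c • -f j ((y h).mulVec v)
    rw [Matrix.smul_mulVec, map_smul, smul_neg]

lemma isPolyFamily_deltaRight (X : QuiverRep I) : IsPolyFamily (ν := ν) (deltaRight X) := by
  refine isPolyFamily_of_affine
    { toFun := fun f i j h => - f j ∘ₗ X.map h
      map_add' := fun f g => ?_
      map_smul' := fun c f => ?_ }
    (fun y =>
    { toFun := fun f i j h => Matrix.mulVecLin (y h) ∘ₗ f i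
      map_add' := fun f g => ?_
      map_smul' := fun c f => ?_ }) (fun y => ?_) (fun y z => ?_) fun c y => ?_
  · funext i j h
    refine LinearMap.ext fun v => ?_
    simp
    abel
  · funext i j h
    refine LinearMap.ext fun v => ?_
    simp
  · funext i j h
    refine LinearMap.ext fun v => ?_
    exact map_add (Matrix.mulVecLin (y h)) _ _
  · funext i j h
    refine LinearMap.ext fun v => ?_
    exact map_smul (Matrix.mulVecLin (y h)) c _
  · refine LinearMap.ext fun f => ?_
    funext i j h
    refine LinearMap.ext fun v => ?_
    change (y h).mulVec (f i v) - f j (X.map h v) = -f j (X.map h v) + (y h).mulVec (f i v)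
    abel
  · refine LinearMap.ext fun f => ?_
    funext i j h
    refine LinearMap.ext fun v => ?_
    exact Matrix.add_mulVec (y h) (z h) (f i v)
  · refine LinearMap.ext fun f => ?_
    funext i j h
    refine LinearMap.ext fun v => ?_
    exact Matrix.smul_mulVec c (y h) (f i v)

/-- The isomorphism class of a rigid point is a neighbourhood. -/
lemma exists_polyFun_of_extVanish {x : RepSpace ν} (hx : ExtVanish x.toRep x.toRep) :
    ∃ φ ∈ polyFun ν, φ x ≠ 0 ∧ ∀ y, φ y ≠ 0 → IsIso y.toRep x.toRep := by
  classical
  have := Fintype.ofFinite I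
  -- Rigidity means that `delta` is surjective at x, so the identity of x extends to homomorphisms
  -- s(y) from y to x depending polynomially on y. They are invertible where the determinants at all
  -- vertices are nonzero.
  obtain ⟨s, hs, hsx, hsD⟩ := (isPolyFamily_deltaLeft (ν := ν) x.toRep).exists_kernel_vector hx
    (v := fun _ => LinearMap.id) (LinearMap.mem_ker.1 (idMap_mem x.toRep))
  let t : RepSpace ν → ∀ i, (Fin (ν i) → ℂ) →ₗ[ℂ] (Fin (ν i) → ℂ) := s
  have htx : t x = fun _ => LinearMap.id := hsx
  refine ⟨∏ i, fun y => (LinearMap.toMatrix' (t y i)).det,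
    Subalgebra.prod_mem _ fun i _ => det_mem_polyFun fun a b => ?_, ?_, fun y hy => ?_⟩
  · exact hs (LinearMap.proj a ∘ₗ LinearMap.applyₗ (Pi.single b 1) ∘ₗ
      LinearMap.proj (φ := fun i => (Fin (ν i) → ℂ) →ₗ[ℂ] (Fin (ν i) → ℂ)) i)
  · rw [Finset.prod_apply]
    refine Finset.prod_ne_zero_iff.2 fun i _ => ?_
    rw [htx, LinearMap.toMatrix'_id, Matrix.det_one]
    exact one_ne_zero
  · rw [Finset.prod_apply] at hy
    have hmem : (s y : VertexMaps y.toRep x.toRep) ∈ Hom y.toRep x.toRep := hsD y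
    refine isIso_iff.2 ⟨s y, hmem, fun i => ?_⟩
    have hi := Finset.prod_ne_zero_iff.1 hy i (Finset.mem_univ i)
    rw [LinearMap.det_toMatrix'] at hi
    have hb : Function.Bijective (t y i) := (Module.End.isUnit_iff (t y i)).1
      ((LinearMap.isUnit_iff_isUnit_det _).2 (isUnit_iff_ne_zero.2 hi))
    exact hb

/-- Both isomorphism classes contain nonempty open sets, and these meet because 𝔼_ν is irreducible.
-/
lemma isIso_of_extVanish {x y : RepSpace ν} (hx : ExtVanish x.toRep x.toRep)
    (hy : ExtVanish y.toRep y.toRep) : IsIso x.toRep y.toRep := by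
  obtain ⟨φ, hφ, hφx, hφ'⟩ := exists_polyFun_of_extVanish hx
  obtain ⟨ψ, hψ, hψy, hψ'⟩ := exists_polyFun_of_extVanish hy
  obtain ⟨z, hz, hz'⟩ := exists_ne_zero_of_polyFun hφ hψ hφx hψy
  exact (hφ' z hz).symm.trans (hψ' z hz')

lemma isZariskiOpen_glOrbit {x : RepSpace ν} (hx : ExtVanish x.toRep x.toRep) :
    IsZariskiOpen (glOrbit x) := by
  -- Every point of the orbit is rigid too and has its own basic neighbourhood in the orbit, so all
  -- polynomials whose nonvanishing locus lies in the orbit serve as equations.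
  refine ⟨{f | ∀ y : RepSpace ν, MvPolynomial.eval y.coord f ≠ 0 → y ∈ glOrbit x}, ?_⟩
  ext y
  constructor
  · intro hy
    have hiso := mem_glOrbit_iff.1 hy
    obtain ⟨φ, hφ, hφy, hφ'⟩ := exists_polyFun_of_extVanish (hiso.extVanish hiso hx)
    obtain ⟨f, hf⟩ := mem_polyFun.1 hφ
    refine ⟨f, fun z hz => ?_, by rwa [← hf]⟩
    rw [← hf] at hz
    exact mem_glOrbit_iff.2 (hiso.trans (hφ' z hz).symm)
  · rintro ⟨f, hf, hfy⟩
    exact hf y hfy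

omit [Finite I] [∀ i j : I, Finite (i ⟶ j)] in
lemma glOrbit_eq_of_isZariskiOpen {x y : RepSpace ν} (hx : IsZariskiOpen (glOrbit x))
    (hy : IsZariskiOpen (glOrbit y)) : glOrbit y = glOrbit x := by
  obtain ⟨S, hS⟩ := hx
  obtain ⟨T, hT⟩ := hy
  have h1 := mem_glOrbit_self x
  have h2 := mem_glOrbit_self y
  rw [hS] at h1
  rw [hT] at h2
  obtain ⟨f, hf, hfx⟩ := h1
  obtain ⟨g, hg, hgy⟩ := h2
  obtain ⟨z, hz, hz'⟩ := exists_ne_zero_of_polyFun (mem_polyFun.2 ⟨f, fun _ => rfl⟩)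
    (mem_polyFun.2 ⟨g, fun _ => rfl⟩) hfx hgy
  have hzx : z ∈ glOrbit x := by
    rw [hS]
    exact ⟨f, hf, hz⟩
  have hzy : z ∈ glOrbit y := by
    rw [hT]
    exact ⟨g, hg, hz'⟩
  rw [← glOrbit_eq_of_mem hzx, glOrbit_eq_of_mem hzy]

end Orbits

/-! ### Rigid representations are generic -/

namespace QuiverRep

section Generic

variable {I : Type u} [Quiver.{v} I] [Fintype I] [∀ i j : I, Finite (i ⟶ j)]

omit [Fintype I] [∀ i j : I, Finite (i ⟶ j)] in
lemma exists_dimVec_natCast (M : QuiverRep I) : ∃ ν : I → ℕ, M.dimVec = fun i => (ν i : ℤ) :=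
  ⟨fun i => finrank ℂ (M.space i), rfl⟩

/-- Two rigid representations of the same dimension vector are isomorphic. -/
theorem ExtVanish.isIso {M N : QuiverRep I} [M.FinDim] [N.FinDim] (hM : ExtVanish M M)
    (hN : ExtVanish N N) (h : M.dimVec = N.dimVec) : IsIso M N := by
  obtain ⟨ν, hν⟩ := exists_dimVec_natCast M
  obtain ⟨x, hx⟩ := exists_isIso_toRep hν
  obtain ⟨y, hy⟩ := exists_isIso_toRep (h.symm.trans hν)
  exact (hx.symm.trans (isIso_of_extVanish (hx.symm.extVanish hx.symm hM)
    (hy.symm.extVanish hy.symm hN))).trans hy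

/-- Generic points are isomorphic to M, and near the point of N the dimension of Hom(·, X) does not
exceed its value at N. By irreducibility some point has both properties. -/
lemma ExtVanish.homDim_le_left {M N : QuiverRep I} [M.FinDim] [N.FinDim] (hM : ExtVanish M M)
    (h : M.dimVec = N.dimVec) (X : QuiverRep I) [X.FinDim] : homDim M X ≤ homDim N X := by
  obtain ⟨ν, hν⟩ := exists_dimVec_natCast M
  obtain ⟨x, hx⟩ := exists_isIso_toRep hν
  obtain ⟨y, hy⟩ := exists_isIso_toRep (h.symm.trans hν)
  obtain ⟨φ, hφ, hφx, hφ'⟩ := exists_polyFun_of_extVanish (hx.symm.extVanish hx.symm hM)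
  obtain ⟨ψ, hψ, hψy, hψ'⟩ := (isPolyFamily_deltaLeft (ν := ν) X).exists_finrank_ker_le y
  obtain ⟨z, hz, hz'⟩ := exists_ne_zero_of_polyFun hφ hψ hφx hψy
  have h1 : homDim z.toRep X ≤ homDim y.toRep X := hψ' z hz'
  rwa [((hφ' z hz).trans hx).homDim_eq (IsIso.refl X), hy.homDim_eq (IsIso.refl X)] at h1

lemma ExtVanish.homDim_le_right {M N : QuiverRep I} [M.FinDim] [N.FinDim] (hM : ExtVanish M M)
    (h : M.dimVec = N.dimVec) (X : QuiverRep I) [X.FinDim] : homDim X M ≤ homDim X N := by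
  obtain ⟨ν, hν⟩ := exists_dimVec_natCast M
  obtain ⟨x, hx⟩ := exists_isIso_toRep hν
  obtain ⟨y, hy⟩ := exists_isIso_toRep (h.symm.trans hν)
  obtain ⟨φ, hφ, hφx, hφ'⟩ := exists_polyFun_of_extVanish (hx.symm.extVanish hx.symm hM)
  obtain ⟨ψ, hψ, hψy, hψ'⟩ := (isPolyFamily_deltaRight (ν := ν) X).exists_finrank_ker_le y
  obtain ⟨z, hz, hz'⟩ := exists_ne_zero_of_polyFun hφ hψ hφx hψy
  have h1 : homDim X z.toRep ≤ homDim X y.toRep := hψ' z hz'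
  rwa [(IsIso.refl X).homDim_eq ((hφ' z hz).trans hx), (IsIso.refl X).homDim_eq hy] at h1

end Generic

end QuiverRep

namespace QuiverRep

/-! ### Indecomposable representations and roots -/

section Roots

variable {I : Type u} [Quiver.{v} I]

lemma dimVec_nonneg (M : QuiverRep I) : 0 ≤ M.dimVec := fun _ => Int.natCast_nonneg _

lemma IsIso.pi {ι : Type} {M N : ι → QuiverRep I} (h : ∀ k, IsIso (M k) (N k)) :
    IsIso (pi M) (pi N) := by
  choose e he using h
  exact ⟨fun i => LinearEquiv.piCongrRight fun k => e k i,
    fun i j a v => funext fun k => he k i j a (v k)⟩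

lemma exists_mem_Hom_ne_zero {M N : QuiverRep I} [M.FinDim] [N.FinDim] (h : homDim M N ≠ 0) :
    ∃ f ∈ Hom M N, f ≠ 0 := by
  by_contra! h0
  refine h ?_
  have : Hom M N = ⊥ := (Submodule.eq_bot_iff _).2 h0
  rw [homDim, this, finrank_bot]

variable [Fintype I]

/-- A nonzero homomorphism factors through an indecomposable summand of its image. -/
lemma exists_factorization {M N : QuiverRep I} [N.FinDim] {f : VertexMaps M N}
    (hf : f ∈ Hom M N) (h0 : f ≠ 0) :
    ∃ P : QuiverRep I, P.FinDim ∧ P.IsIndecomposable ∧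
      (∃ q ∈ Hom M P, ∀ i, Function.Surjective (q i)) ∧
      ∃ j ∈ Hom P N, ∀ i, Function.Injective (j i) := by
  classical
  obtain ⟨ι, _, P, hP, hPf, hiso⟩ := exists_decomposition (N.sub _ (isSubrep_range hf))
  obtain ⟨e, he, heb⟩ := isIso_iff.1 hiso
  obtain ⟨e', he', heb'⟩ := isIso_iff.1 hiso.symm
  rcases isEmpty_or_nonempty ι with h | ⟨⟨a⟩⟩
  · refine absurd (funext fun i => LinearMap.ext fun x => ?_) h0
    have h1 : toRange hf i x = 0 := (heb i).1 (funext fun k => h.elim k)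
    exact congrArg Subtype.val h1
  · refine ⟨P a, hPf a, hP a,
      ⟨_, comp_mem (piProj_mem P a) (comp_mem he (toRange_mem hf)), fun i =>
        (piProj_surjective P a i).comp ((heb i).2.comp (toRange_surjective hf i))⟩,
      ⟨_, comp_mem (subIncl_mem N _ (isSubrep_range hf)) (comp_mem he' (piSingle_mem P a)),
        fun i => (subIncl_injective N _ _ i).comp
          ((heb' i).1.comp (piSingle_injective P a i))⟩⟩

variable [DecidableEq I]

lemma IsIndecomposable.eulerForm_dimVec_self (hQ : IsDynkinQuiver I) {M : QuiverRep I} [M.FinDim]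
    (hM : M.IsIndecomposable) : eulerForm I M.dimVec M.dimVec = 1 := by
  have := hQ.finite_arrows
  obtain ⟨h1, h2⟩ := hM.homDim_self_eq_one_and_extVanish hQ
  rw [← h2.homDim_eq, h1, Nat.cast_one]

lemma IsIndecomposable.exists_dimVec_eq (hQ : IsDynkinQuiver I) {w : List I}
    (hw : IsReducedWordOfLongest w) {M : QuiverRep I} [M.FinDim] (hM : M.IsIndecomposable) :
    ∃ k, M.dimVec = wordRoot w k := by
  refine hw.exists_wordRoot hQ ?_ M.dimVec_nonneg
  rw [hQ.cartanForm_eq, hM.eulerForm_dimVec_self hQ]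
  rfl

lemma IsIndecomposable.isIso (hQ : IsDynkinQuiver I) {M N : QuiverRep I} [M.FinDim] [N.FinDim]
    (hM : M.IsIndecomposable) (hN : N.IsIndecomposable) (h : M.dimVec = N.dimVec) : IsIso M N := by
  have := hQ.finite_arrows
  exact (hM.homDim_self_eq_one_and_extVanish hQ).2.isIso
    (hN.homDim_self_eq_one_and_extVanish hQ).2 h

/-- Every positive root is the dimension vector of an indecomposable representation. -/
theorem exists_isIndecomposable (hQ : IsDynkinQuiver I) {β : I → ℤ} (h0 : 0 ≤ β)
    (hβ : cartanForm I β β = 2) :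
    ∃ M : QuiverRep I, M.FinDim ∧ M.IsIndecomposable ∧ M.dimVec = β := by
  have := hQ.finite_arrows
  obtain ⟨ι, _, N, hN, hNf, hd, hE⟩ := exists_rigid hQ fun i => (β i).toNat
  have hd' : (pi N).dimVec = β := by
    rw [hd]
    exact funext fun i => Int.toNat_of_nonneg (h0 i)
  have hEE : ExtVanish (pi N) (pi N) :=
    extVanish_pi_left fun k => extVanish_pi_right fun l => hE k l
  -- For a rigid representation dim End = ⟨β, β⟩ = (β, β)/2 = 1. Each summand contributes its
  -- identity map, so there is at most one.
  have h1 : homDim (pi N) (pi N) = 1 := by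
    have h2 := hEE.homDim_eq
    have h3 := hQ.cartanForm_eq β β
    rw [hd'] at h2
    omega
  have hcard : Fintype.card ι ≤ 1 := by
    rw [← h1, homDim_pi_left, ← Finset.card_univ, Finset.card_eq_sum_ones]
    refine Finset.sum_le_sum fun k _ => ?_
    rw [homDim_pi_right, ← ((hN k).homDim_self_eq_one_and_extVanish hQ).1]
    exact Finset.single_le_sum (f := fun l => homDim (N k) (N l)) (fun _ _ => Nat.zero_le _)
      (Finset.mem_univ k)
  have := Fintype.card_le_one_iff_subsingleton.1 hcard
  rw [dimVec_pi] at hd'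
  rcases isEmpty_or_nonempty ι with h | ⟨⟨k⟩⟩
  · rw [Finset.univ_eq_empty, Finset.sum_empty] at hd'
    rw [← hd'] at hβ
    simp at hβ
  · refine ⟨N k, hNf k, hN k, ?_⟩
    rw [← hd']
    exact (Fintype.sum_subsingleton (fun k => (N k).dimVec) k).symm

/-- There are no homomorphisms from an indecomposable representation to one whose root comes
earlier in an adapted word. -/
theorem IsIndecomposable.homDim_eq_zero (hQ : IsDynkinQuiver I) {w : List I}
    (hw : IsReducedWordOfLongest w) (ha : IsAdaptedWord w) {M N : QuiverRep I} [M.FinDim]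
    [N.FinDim] (hM : M.IsIndecomposable) (hN : N.IsIndecomposable) {k l : Fin w.length}
    (hk : N.dimVec = wordRoot w k) (hl : M.dimVec = wordRoot w l) (hkl : k < l) :
    homDim M N = 0 := by
  have := hQ.finite_arrows
  by_contra h
  obtain ⟨f, hf, hf0⟩ := exists_mem_Hom_ne_zero h
  obtain ⟨P, hPf, hP, ⟨q, hq, hqs⟩, j, hj, hji⟩ := exists_factorization hf hf0
  obtain ⟨m, hm⟩ := hP.exists_dimVec_eq hQ hw
  obtain ⟨i, hi⟩ := hP.1
  obtain ⟨x, hx⟩ := exists_ne (0 : P.space i)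
  -- P is a quotient of M and a subrepresentation of N. If m < l, then Ext¹(M, P) = 0 and dim Hom(M,
  -- P) = ⟨β_l, β_m⟩ ≤ 0, although Hom(M, P) contains q. If m ≥ l > k, the same happens to Ext¹(P,
  -- N), ⟨β_m, β_k⟩ and j.
  rcases lt_or_ge m l with hml | hml
  · have hE := ((hM.homDim_self_eq_one_and_extVanish hQ).2.of_surjective hq hqs).homDim_eq
    have h1 := ha.eulerForm_wordRoot_nonpos hQ hw.isReducedWord hml
    have h2 := homDim_pos hq (by
      rintro rfl
      obtain ⟨y, hy⟩ := hqs i x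
      exact hx hy.symm)
    rw [hm, hl] at hE
    omega
  · have hE := ((hN.homDim_self_eq_one_and_extVanish hQ).2.of_injective hj hji).homDim_eq
    have h1 := ha.eulerForm_wordRoot_nonpos hQ hw.isReducedWord (hkl.trans_le hml)
    have h2 := homDim_pos hj (by
      rintro rfl
      exact hx (hji i rfl))
    rw [hm, hk] at hE
    omega

end Roots

end QuiverRep

/-! ### Comparison of sorted lists -/

section Lists

variable {α : Type*} {r : α → α → Prop}

lemma FirstDiff.cons {a b : List α} (c : α) (h : FirstDiff r a b) :
    FirstDiff r (c :: a) (c :: b) := by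
  obtain ⟨k, ha, hb, ht, hr⟩ := h
  exact ⟨k + 1, by simpa using ha, by simpa using hb, by simpa using ht, by simpa using hr⟩

lemma FirstDiff.asymm (hr : ∀ x y, r x y → ¬ r y x) {a b : List α} (h : FirstDiff r a b) :
    ¬ FirstDiff r b a := by
  rintro ⟨l, hb', ha', ht', hr'⟩
  obtain ⟨k, ha, hb, ht, hrk⟩ := h
  rcases lt_trichotomy k l with hkl | rfl | hkl
  · have : b[k] = a[k] := by
      have := congrArg (fun L : List α => L[k]?) ht'
      simpa [hkl, ha, hb] using this
    rw [this] at hrk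
    exact hr _ _ hrk hrk
  · exact hr _ _ hrk hr'
  · have : a[l] = b[l] := by
      have := congrArg (fun L : List α => L[l]?) ht
      simpa [hkl, ha', hb'] using this
    rw [this] at hr'
    exact hr _ _ hr' hr'

/-- Two sorted lists are compared at their first difference by means of a triangular family of
additive functions. -/
lemma firstDiff_of_sum_le (htrans : ∀ x y z, r x y → r y z → r x z) {f : α → α → ℕ}
    {A B : List α} (hA : A.Pairwise fun x y => r x y ∨ y = x)
    (hB : B.Pairwise fun x y => r x y ∨ y = x)
    (htri : ∀ a ∈ A, ∀ b ∈ B, r a b ∨ a = b ∨ r b a) (hpos : ∀ a ∈ A, 0 < f a a)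
    (hzero : ∀ a ∈ A, ∀ b ∈ B, r a b → f a b = 0)
    (hle : ∀ a ∈ A, (A.map (f a)).sum ≤ (B.map (f a)).sum)
    (hAB : ¬ A <+: B) (hBA : ¬ B <+: A) : FirstDiff (fun a b => r b a) A B := by
  induction A generalizing B with
  | nil => exact absurd List.nil_prefix hAB
  | cons a A ih =>
    cases B with
    | nil => exact absurd List.nil_prefix hBA
    | cons b B =>
      rw [List.pairwise_cons] at hA hB
      -- If a came strictly before b, it would come before all of B, so f a would sum to zero over B
      -- but not over A. Equal heads contribute equally to both sums and cancel.
      rcases htri a List.mem_cons_self b List.mem_cons_self with h | rfl | h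
      · have h1 : ((b :: B).map (f a)).sum = 0 := by
          refine List.sum_eq_zero fun x hx => ?_
          obtain ⟨c, hc, rfl⟩ := List.mem_map.1 hx
          refine hzero a List.mem_cons_self c hc ?_
          rcases List.mem_cons.1 hc with rfl | hc
          · exact h
          · rcases hB.1 c hc with h' | rfl
            · exact htrans _ _ _ h h'
            · exact h
        have h2 := hle a List.mem_cons_self
        have h3 := hpos a List.mem_cons_self
        rw [h1, List.map_cons, List.sum_cons] at h2
        omega
      · refine FirstDiff.cons a (ih hA.2 hB.2 ?_ ?_ ?_ ?_ ?_ ?_)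
        · exact fun x hx y hy => htri x (List.mem_cons_of_mem _ hx) y (List.mem_cons_of_mem _ hy)
        · exact fun x hx => hpos x (List.mem_cons_of_mem _ hx)
        · exact fun x hx y hy => hzero x (List.mem_cons_of_mem _ hx) y (List.mem_cons_of_mem _ hy)
        · intro x hx
          have := hle x (List.mem_cons_of_mem _ hx)
          simpa using this
        · simpa using hAB
        · simpa using hBA
      · exact ⟨0, by simp, by simp, by simp, by simpa using h⟩

lemma list_eq_nil_of_sum_eq_zero {ι : Type*} {L : List (ι → ℤ)}
    (hL : ∀ β ∈ L, 0 ≤ β ∧ β ≠ 0) (h : L.sum = 0) :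
    L = [] := by
  cases L with
  | nil => rfl
  | cons a L =>
    have h1 : 0 ≤ L.sum := List.sum_nonneg fun x hx => (hL x (List.mem_cons_of_mem _ hx)).1
    have h2 := hL a List.mem_cons_self
    rw [List.sum_cons] at h
    refine absurd (le_antisymm ?_ h2.1) h2.2
    rw [← h]
    exact le_add_of_nonneg_right h1

/-- Needed because `FirstDiff` demands an entry of both sequences: the surplus of a longer one would
be a list of nonzero nonnegative vectors with sum zero. -/
lemma list_eq_of_prefix {ι : Type*} {L L' : List (ι → ℤ)}
    (hL : ∀ β ∈ L', 0 ≤ β ∧ β ≠ 0) (h : L.sum = L'.sum)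
    (hp : L <+: L') : L = L' := by
  obtain ⟨C, rfl⟩ := hp
  rw [List.sum_append, left_eq_add] at h
  rw [list_eq_nil_of_sum_eq_zero (fun β hβ => hL β (List.mem_append_right _ hβ)) h, List.append_nil]

lemma list_sum_get {M : Type*} [AddCommMonoid M] {β : Type*} (L : List β) (f : β → M) :
    ∑ k : Fin L.length, f (L.get k) = (L.map f).sum := by
  rw [← List.sum_ofFn]
  congr 1
  exact (List.map_ofFn (f := L.get) (g := f)).symm.trans (by rw [List.ofFn_get])

end Lists

/-! ### Kostant partitions -/

namespace KostantPartition

open QuiverRep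

variable {I : Type u} [Fintype I] [DecidableEq I] [Quiver.{v} I] {w : List I} {ν : I → ℕ}

lemma eq_of_parts_eq {κ μ : KostantPartition w ν} (h : κ.parts = μ.parts) : κ = μ := by
  cases κ
  cases μ
  subst h
  rfl

lemma nonneg_and_ne_zero (κ : KostantPartition w ν) {β : I → ℤ} (hβ : β ∈ κ.parts) :
    0 ≤ β ∧ β ≠ 0 := by
  obtain ⟨h0, u, i, rfl⟩ := κ.isPositiveRoot β hβ
  refine ⟨h0, fun h => ?_⟩
  have h1 := cartanForm_wordProd u (Pi.single i 1) (Pi.single i 1)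
  rw [h, cartanForm_single_single, quiverCartan_self] at h1
  simp at h1

lemma rootPrec_asymm (hQ : IsDynkinQuiver I) (hw : IsReducedWordOfLongest w) (β γ : I → ℤ) :
    rootPrec w β γ → ¬ rootPrec w γ β := by
  rintro ⟨k, l, hkl, rfl, rfl⟩ ⟨k', l', hkl', h1, h2⟩
  have e1 := hw.isReducedWord.wordRoot_injective hQ h1
  have e2 := hw.isReducedWord.wordRoot_injective hQ h2
  omega

lemma rootPrec_trans (hQ : IsDynkinQuiver I) (hw : IsReducedWordOfLongest w) (α β γ : I → ℤ) :
    rootPrec w α β → rootPrec w β γ → rootPrec w α γ := by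
  rintro ⟨k, l, hkl, rfl, rfl⟩ ⟨k', l', hkl', h1, rfl⟩
  have e1 := hw.isReducedWord.wordRoot_injective hQ h1
  exact ⟨k, l', by omega, rfl, rfl⟩

lemma rootPrec_trichotomy (hQ : IsDynkinQuiver I) (hw : IsReducedWordOfLongest w) {β γ : I → ℤ}
    (hβ : IsPositiveRoot β) (hγ : IsPositiveRoot γ) :
    rootPrec w β γ ∨ β = γ ∨ rootPrec w γ β := by
  obtain ⟨k, rfl⟩ := (hw.isPositiveRoot_iff hQ).1 hβ
  obtain ⟨l, rfl⟩ := (hw.isPositiveRoot_iff hQ).1 hγ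
  rcases lt_trichotomy k l with h | rfl | h
  · exact Or.inr (Or.inr ⟨l, k, h, rfl, rfl⟩)
  · exact Or.inr (Or.inl rfl)
  · exact Or.inl ⟨k, l, h, rfl, rfl⟩

lemma Prec.asymm (hQ : IsDynkinQuiver I) (hw : IsReducedWordOfLongest w)
    {κ μ : KostantPartition w ν} (h : κ.Prec μ) : ¬ μ.Prec κ := fun h' =>
  h.1.asymm (rootPrec_asymm hQ hw) h'.1

/-- A choice of an indecomposable representation for every positive root. -/
structure IsRootFamily (D : (I → ℤ) → QuiverRep I) : Prop where
  finDim : ∀ β, (D β).FinDim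
  isIndecomposable : ∀ β, IsPositiveRoot β → (D β).IsIndecomposable
  dimVec_eq : ∀ β, IsPositiveRoot β → (D β).dimVec = β

lemma exists_isRootFamily (hQ : IsDynkinQuiver I) :
    ∃ D : (I → ℤ) → QuiverRep I, IsRootFamily D := by
  have : ∀ β : I → ℤ, ∃ M : QuiverRep I, M.FinDim ∧
      (IsPositiveRoot β → M.IsIndecomposable ∧ M.dimVec = β) := by
    intro β
    by_cases hβ : IsPositiveRoot β
    · obtain ⟨h0, u, i, rfl⟩ := hβ
      obtain ⟨M, h1, h2, h3⟩ := exists_isIndecomposable hQ h0 (by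
        rw [cartanForm_wordProd, cartanForm_single_single, quiverCartan_self])
      exact ⟨M, h1, fun _ => ⟨h2, h3⟩⟩
    -- Off the positive roots the value is irrelevant; the zero representation keeps the family
    -- finite-dimensional.
    · obtain ⟨M, h1, -⟩ := exists_dimVec_eq fun _ : I => 0
      exact ⟨M, h1, fun h => absurd h hβ⟩
  choose D h1 h2 using this
  exact ⟨D, h1, fun β hβ => (h2 β hβ).1, fun β hβ => (h2 β hβ).2⟩

variable {D : (I → ℤ) → QuiverRep I}

/-- The representation `M(κ_1) ⊕ ⋯ ⊕ M(κ_l)`. -/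
def rep (κ : KostantPartition w ν) (D : (I → ℤ) → QuiverRep I) : QuiverRep I :=
  QuiverRep.pi fun k : Fin κ.parts.length => D (κ.parts.get k)

lemma rep_finDim (hD : IsRootFamily D) (κ : KostantPartition w ν) : (κ.rep D).FinDim :=
  have := hD.finDim
  pi.finDim _

lemma dimVec_rep (hD : IsRootFamily D) (κ : KostantPartition w ν) :
    (κ.rep D).dimVec = fun i => (ν i : ℤ) := by
  have := hD.finDim
  rw [rep, dimVec_pi, ← κ.sum_eq, list_sum_get κ.parts fun β => (D β).dimVec]
  congr 1
  exact (List.map_congr_left fun β hβ => hD.dimVec_eq β (κ.isPositiveRoot β hβ)).trans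
    (List.map_id _)

lemma homDim_rep_left (hD : IsRootFamily D) (κ : KostantPartition w ν) (β : I → ℤ) :
    homDim (κ.rep D) (D β) = (κ.parts.map fun γ => homDim (D γ) (D β)).sum := by
  have := hD.finDim
  rw [rep, homDim_pi_left, list_sum_get κ.parts fun γ => homDim (D γ) (D β)]

lemma homDim_rep_right (hD : IsRootFamily D) (κ : KostantPartition w ν) (β : I → ℤ) :
    homDim (D β) (κ.rep D) = (κ.parts.map fun γ => homDim (D β) (D γ)).sum := by
  have := hD.finDim
  rw [rep, homDim_pi_right, list_sum_get κ.parts fun γ => homDim (D β) (D γ)]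

/-- The choice of M(β) is immaterial, since indecomposables with equal dimension vectors are
isomorphic. -/
lemma mem_orbit_iff (hQ : IsDynkinQuiver I) (hD : IsRootFamily D) (κ : KostantPartition w ν)
    {x : RepSpace ν} : x ∈ κ.orbit ↔ IsIso x.toRep (κ.rep D) := by
  have hf := hD.finDim
  have hroot : ∀ k, IsPositiveRoot (κ.parts.get k) := fun k =>
    κ.isPositiveRoot _ (List.get_mem _ _)
  constructor
  · rintro ⟨M, hM, hx⟩
    refine hx.trans (IsIso.pi fun k => ?_)
    obtain ⟨h1, h2⟩ := hasDimVector_iff.1 (hM k).2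
    exact (hM k).1.isIso hQ (hD.isIndecomposable _ (hroot k))
      (h2.trans (hD.dimVec_eq _ (hroot k)).symm)
  · exact fun hx => ⟨fun k => D (κ.parts.get k), fun k => ⟨hD.isIndecomposable _ (hroot k),
      hasDimVector_iff.2 ⟨hf _, hD.dimVec_eq _ (hroot k)⟩⟩, hx⟩

lemma homDim_eq_zero_of_rootPrec (hQ : IsDynkinQuiver I) (hw : IsReducedWordOfLongest w)
    (ha : IsAdaptedWord w) (hD : IsRootFamily D) {β γ : I → ℤ} (hβ : IsPositiveRoot β)
    (hγ : IsPositiveRoot γ) (h : rootPrec w β γ) : homDim (D β) (D γ) = 0 := by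
  have hf := hD.finDim
  obtain ⟨k, l, hlk, hk, hl⟩ := h
  exact (hD.isIndecomposable β hβ).homDim_eq_zero hQ hw ha (hD.isIndecomposable γ hγ)
    ((hD.dimVec_eq γ hγ).trans hl) ((hD.dimVec_eq β hβ).trans hk) hlk

/-- The Kostant partition of a rigid representation is smaller than every other one. -/
theorem prec_of_extVanish (hQ : IsDynkinQuiver I) (hw : IsReducedWordOfLongest w)
    (ha : IsAdaptedWord w) (hD : IsRootFamily D) {κ μ : KostantPartition w ν}
    (hκ : ExtVanish (κ.rep D) (κ.rep D)) (hne : κ ≠ μ) : κ.Prec μ := by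
  have hf := hD.finDim
  have hfin := hQ.finite_arrows
  have hfκ := rep_finDim hD κ
  have hfμ := rep_finDim hD μ
  have hd : (κ.rep D).dimVec = (μ.rep D).dimVec :=
    (dimVec_rep hD κ).trans (dimVec_rep hD μ).symm
  have hne' : κ.parts ≠ μ.parts := fun h => hne (eq_of_parts_eq h)
  have hsum : κ.parts.sum = μ.parts.sum := κ.sum_eq.trans μ.sum_eq.symm
  have hpos : ∀ β, IsPositiveRoot β → 0 < homDim (D β) (D β) := fun β hβ => by
    rw [((hD.isIndecomposable β hβ).homDim_self_eq_one_and_extVanish hQ).1]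
    exact one_pos
  constructor
  -- Parts are listed from the ≺-largest down, and M(γ) has no map to M(β) for γ ≺ β. So the left
  -- comparison tests with Hom(·, M(β)).
  · refine firstDiff_of_sum_le (r := fun β γ => rootPrec w γ β)
      (f := fun β γ => homDim (D γ) (D β)) (fun α β γ h h' => rootPrec_trans hQ hw _ _ _ h' h)
      κ.sorted μ.sorted ?_ ?_ ?_ ?_ ?_ ?_
    · exact fun β hβ γ hγ => (rootPrec_trichotomy hQ hw (μ.isPositiveRoot γ hγ)
        (κ.isPositiveRoot β hβ)).imp_right (Or.imp_left Eq.symm)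
    · exact fun β hβ => hpos β (κ.isPositiveRoot β hβ)
    · exact fun β hβ γ hγ h => homDim_eq_zero_of_rootPrec hQ hw ha hD (μ.isPositiveRoot γ hγ)
        (κ.isPositiveRoot β hβ) h
    · intro β _
      rw [← homDim_rep_left hD, ← homDim_rep_left hD]
      exact hκ.homDim_le_left hd (D β)
    · exact fun h => hne' (list_eq_of_prefix (fun β => μ.nonneg_and_ne_zero) hsum h)
    · exact fun h => hne' (list_eq_of_prefix (fun β => κ.nonneg_and_ne_zero) hsum.symm h).symm
  -- The reversed sequences increase for ≺, so the roles of the two arguments of Hom are exchanged.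
  · refine firstDiff_of_sum_le (r := rootPrec w)
      (f := fun β γ => homDim (D β) (D γ)) (rootPrec_trans hQ hw)
      (List.pairwise_reverse.2 (κ.sorted.imp fun h => h.imp_right Eq.symm))
      (List.pairwise_reverse.2 (μ.sorted.imp fun h => h.imp_right Eq.symm)) ?_ ?_ ?_ ?_ ?_ ?_
    · exact fun β hβ γ hγ => rootPrec_trichotomy hQ hw
        (κ.isPositiveRoot β (List.mem_reverse.1 hβ)) (μ.isPositiveRoot γ (List.mem_reverse.1 hγ))
    · exact fun β hβ => hpos β (κ.isPositiveRoot β (List.mem_reverse.1 hβ))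
    · exact fun β hβ γ hγ h => homDim_eq_zero_of_rootPrec hQ hw ha hD
        (κ.isPositiveRoot β (List.mem_reverse.1 hβ)) (μ.isPositiveRoot γ (List.mem_reverse.1 hγ)) h
    · intro β _
      rw [List.map_reverse, List.map_reverse, List.sum_reverse, List.sum_reverse,
        ← homDim_rep_right hD, ← homDim_rep_right hD]
      exact hκ.homDim_le_right hd (D β)
    · exact fun h => hne' (List.reverse_injective (list_eq_of_prefix
        (fun β hβ => μ.nonneg_and_ne_zero (List.mem_reverse.1 hβ)) (by simpa using hsum) h))
    · exact fun h => hne' (List.reverse_injective (list_eq_of_prefix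
        (fun β hβ => κ.nonneg_and_ne_zero (List.mem_reverse.1 hβ))
        (by simpa using hsum.symm) h)).symm

/-- The rigid representation is given by a Kostant partition. -/
theorem exists_extVanish_rep (hQ : IsDynkinQuiver I) (hw : IsReducedWordOfLongest w)
    (hD : IsRootFamily D) (ν : I → ℕ) :
    ∃ κ : KostantPartition w ν, ExtVanish (κ.rep D) (κ.rep D) := by
  have hf := hD.finDim
  obtain ⟨ι, _, N, hN, hNf, hd, hE⟩ := exists_rigid hQ ν
  choose idx hidx using fun s => (hN s).exists_dimVec_eq hQ hw
  -- Increasing indices give ≺-decreasing roots, as a Kostant partition requires.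
  let L := (Finset.univ.val.map idx).sort (· ≤ ·)
  have hL : ∀ k ∈ L, ∃ s, idx s = k := fun k hk => by
    simpa using (Multiset.mem_sort (· ≤ ·)).1 hk
  have hpos : ∀ k, IsPositiveRoot (wordRoot w k) := fun k =>
    (hw.isPositiveRoot_iff hQ).2 ⟨k, rfl⟩
  refine ⟨⟨L.map (wordRoot w), ?_, ?_, ?_⟩, ?_⟩
  · intro β hβ
    obtain ⟨k, -, rfl⟩ := List.mem_map.1 hβ
    exact hpos k
  · refine List.pairwise_map.2 ((Multiset.pairwise_sort _ (· ≤ ·)).imp fun {k l} hkl => ?_)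
    rcases hkl.lt_or_eq with h | rfl
    · exact Or.inl ⟨l, k, h, rfl, rfl⟩
    · exact Or.inr rfl
  · rw [← hd, dimVec_pi, ← Multiset.sum_coe, ← Multiset.map_coe, Multiset.sort_eq,
      Multiset.map_map]
    exact congrArg Multiset.sum (Multiset.map_congr rfl fun s _ => (hidx s).symm)
  · have hiso : ∀ β ∈ L.map (wordRoot w), ∃ s, IsIso (N s) (D β) := by
      intro β hβ
      obtain ⟨k, hk, rfl⟩ := List.mem_map.1 hβ
      obtain ⟨s, rfl⟩ := hL k hk
      exact ⟨s, (hN s).isIso hQ (hD.isIndecomposable _ (hpos _))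
        ((hidx s).trans (hD.dimVec_eq _ (hpos _)).symm)⟩
    refine extVanish_pi_left fun k => extVanish_pi_right fun l => ?_
    obtain ⟨s, hs⟩ := hiso _ (List.get_mem _ k)
    obtain ⟨t, ht⟩ := hiso _ (List.get_mem _ l)
    exact (hs.extVanish ht (hE s t))

end KostantPartition

/-! ### The main theorem -/

open KostantPartition QuiverRep in
theorem mainTheorem11 {I : Type*} [Fintype I] [DecidableEq I] [Quiver I]
    (hQ : IsDynkinQuiver I)
    (w : List I) (hw : IsReducedWordOfLongest w) (hadapted : IsAdaptedWord w)
    (ν : I → ℕ) :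
    ∃ x : RepSpace ν,
      (∀ y : RepSpace ν, IsZariskiOpen (glOrbit y) ↔ glOrbit y = glOrbit x) ∧
      ∃ ν₀ : KostantPartition w ν,
        (∀ κ : KostantPartition w ν, κ.orbit = glOrbit x ↔ κ = ν₀) ∧
        (∀ κ : KostantPartition w ν, κ ≠ ν₀ → ν₀.Prec κ) ∧
        ∀ κ : KostantPartition w ν, ¬ κ.Prec ν₀ := by
  have hfin := hQ.finite_arrows
  obtain ⟨D, hD⟩ := exists_isRootFamily hQ
  obtain ⟨ν₀, hν₀⟩ := exists_extVanish_rep hQ hw hD ν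
  have := rep_finDim hD ν₀
  obtain ⟨x, hx⟩ := exists_isIso_toRep (dimVec_rep hD ν₀)
  have hopen : IsZariskiOpen (glOrbit x) :=
    isZariskiOpen_glOrbit (hx.symm.extVanish hx.symm hν₀)
  have hprec : ∀ κ : KostantPartition w ν, κ ≠ ν₀ → ν₀.Prec κ := fun κ hκ =>
    prec_of_extVanish hQ hw hadapted hD hν₀ hκ.symm
  refine ⟨x, fun y => ⟨glOrbit_eq_of_isZariskiOpen hopen, fun h => h ▸ hopen⟩, ν₀, fun κ => ?_,
    hprec, fun κ hκ => ?_⟩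
  · constructor
    · intro h
      by_contra hne
      have hxκ : IsIso x.toRep (κ.rep D) :=
        (mem_orbit_iff hQ hD κ).1 (h ▸ mem_glOrbit_self x)
      have hiso := hx.symm.trans hxκ
      -- If κ ≠ ν₀ had the same orbit, its representation would be rigid as well, and each of the
      -- two would precede the other. Uniqueness of decompositions into indecomposables is thus not
      -- needed.
      exact (hprec κ hne).asymm hQ hw
        (prec_of_extVanish hQ hw hadapted hD (hiso.extVanish hiso hν₀) hne)
    · rintro rfl
      ext y
      rw [mem_orbit_iff hQ hD, mem_glOrbit_iff]
      exact ⟨fun hy => hx.trans hy.symm, fun hy => hy.symm.trans hx⟩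
  · by_cases h : κ = ν₀
    · subst h
      exact hκ.asymm hQ hw hκ
    · exact (hprec κ h).asymm hQ hw hκ

end
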